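/- Let $G$ be a finite group; all representations are finite-dimensional and complex. Fix an element $a$ in each conjugacy class $\overline a$ of $G$, and write $Z(a)$ for its centralizer. The particles of $\mathcal Z(G)$ (the irreducible representations of the quantum double $D(G)$, up to isomorphism) are the pairs $(\overline a,\pi)$, where $\overline a$ is a conjugacy class and $\pi$ is an isomorphism class of irreducible representations of $Z(a)$. A particle $(e,\pi)$ is called a chargeon, a particle $(\overline a,\mathbf 1)$ a fluxion, and $\mathbf 0=(e,\mathbf 1)$ is the trivial particle. The matrices $S$ and $T$ of $\mathcal Z(G)$ are indexed by the particles; they are $$S_{(\overline a,\pi)(\overline{a'},\pi')}=\frac1{|Z(a)|\,|Z(a')|}\sum_{h\in G:\ ha'h^{-1}\in Z(a)}\mathrm{tr}_\pi(ha'^{-1}h^{-1})\,\mathrm{tr}_{\pi'}(h^{-1}a^{-1}h),$$ and $T$ is diagonal with $T_{(\overline a,\pi)(\overline a,\pi)}=\mathrm{tr}_\pi(a)/\mathrm{tr}_\pi(e)$. A modular invariant of $\mathcal Z(G)$ is a matrix $M$ with non-negative integer entries that commutes with $S$ and $T$ and has $M_{\mathbf 0\mathbf 0}=1$. A near-field is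 a set $H$ with operations $+$ and $\times$ such that $(H,+)$ is an abelian group with identity $0$, $0\times x=x\times 0=0$ for all $x$, $(H\setminus\{0\},\times)$ is a group with identity $1$, and $x\times(y+z)=x\times y+x\times z$ for all $x,y,z$. For a near-field $H$, let $H^\times=H\setminus\{0\}$, and let $H^+\rtimes H^\times$ be the group of pairs $(a,\alpha)$, $a\in H$, $\alpha\in H^\times$, with $(a,\alpha)(b,\beta)=(a+\alpha\times b,\ \alpha\times\beta)$. **Theorem.** (i) Let $G$ be a finite group, and let $C=(e,\pi)$ be a chargeon and $F=(\overline a,\mathbf 1)$ a fluxion of $\mathcal Z(G)$ with $C\neq F$. If the permutation matrix $P$ of the transposition that interchanges $C$ and $F$ commutes with $S$ and $T$ (in particular, if $P$ is a modular invariant of $\mathcal Z(G)$), then $G\cong H^+\rtimes H^\times$ for some finite near-field $H$. (ii) Conversely, for every finite near-field $H$ there are a chargeon $C$ and a fluxion $F\neq C$ of $\mathcal Z(H^+\rtimes H^\times)$ such that the permutation matrix of the transposition that interchanges $C$ and $F$ is a modular invariant of $\mathcal Z(H^+\rtimes H^\times)$. -/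

import Mathlib

universe u

namespace QuantumDouble

section Irreps

/-- An irreducible finite-dimensional complex representation of `K`, written in coordinates:
every finite-dimensional representation is isomorphic to one on some `ℂⁿ`. -/
structure IrrRep (K : Type u) [Group K] where
  dim : ℕ
  rep : Representation ℂ K (Fin dim → ℂ)
  irr : rep.IsIrreducible

/-- Two irreducible representations are identified when they are isomorphic. -/
instance irrRepSetoid (K : Type u) [Group K] : Setoid (IrrRep K) where
  r V W := Nonempty (V.rep.Equiv W.rep)
  iseqv :=
    { refl := fun V => ⟨Representation.Equiv.refl V.rep⟩
      symm := fun ⟨i⟩ => ⟨i.symm⟩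
      trans := fun ⟨i⟩ ⟨j⟩ => ⟨i.trans j⟩ }

/-- The set of isomorphism classes of irreducible finite-dimensional complex representations
of `K`. -/
def Irr (K : Type u) [Group K] := Quotient (irrRepSetoid K)

/-- The isomorphism class of an irreducible representation. -/
def Irr.mk {K : Type u} [Group K] (V : IrrRep K) : Irr K := Quotient.mk _ V

theorem Irr.exists_rep {K : Type u} [Group K] (π : Irr K) : ∃ V : IrrRep K, Irr.mk V = π :=
  Quotient.exists_rep π

theorem Irr.mk_eq_mk {K : Type u} [Group K] {V W : IrrRep K} :
    Irr.mk V = Irr.mk W ↔ Nonempty (V.rep.Equiv W.rep) :=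
  ⟨fun h => Quotient.exact h, fun h => Quotient.sound h⟩

/-- The character `tr_π` of a class `π` of irreducible representations. -/
noncomputable def Irr.char {K : Type u} [Group K] (π : Irr K) : K → ℂ :=
  Quotient.lift (fun V : IrrRep K => V.rep.character)
    (fun _ _ h => Nonempty.elim h fun i => Representation.char_iso i) π

theorem isIrreducible_trivial (K : Type u) [Group K] :
    (Representation.trivial ℂ K (Fin 1 → ℂ)).IsIrreducible := by
  have h : IsSimpleOrder (Submodule ℂ (Fin 1 → ℂ)) :=
    (isSimpleModule_iff ℂ _).1 (isSimpleModule_iff_finrank_eq_one.2 (by simp))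
  refine { exists_pair_ne := ⟨⊥, ⊤, fun h0 => ?_⟩, eq_bot_or_eq_top := fun W => ?_ }
  · exact bot_ne_top (α := Submodule ℂ (Fin 1 → ℂ))
      (congrArg Subrepresentation.toSubmodule h0)
  · exact (eq_bot_or_eq_top W.toSubmodule).imp
      (fun h1 => Subrepresentation.toSubmodule_injective h1)
      (fun h1 => Subrepresentation.toSubmodule_injective h1)

/-- The class of the trivial representation `𝟏`. -/
def Irr.trivial (K : Type u) [Group K] : Irr K :=
  Irr.mk ⟨1, Representation.trivial ℂ K (Fin 1 → ℂ), isIrreducible_trivial K⟩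

theorem Irr.char_trivial (K : Type u) [Group K] (g : K) : (Irr.trivial K).char g = 1 := by
  have : (Irr.trivial K).char g = LinearMap.trace ℂ (Fin 1 → ℂ) (LinearMap.id) := rfl
  rw [this, LinearMap.trace_id]
  simp

theorem Irr.char_orthonormal {K : Type u} [Group K] [Fintype K] [DecidableEq (Irr K)]
    (π ρ : Irr K) :
    (Nat.card K : ℂ)⁻¹ * ∑ g : K, π.char g * ρ.char g⁻¹ = if π = ρ then 1 else 0 := by
  classical
  obtain ⟨V, rfl⟩ := π.exists_rep
  obtain ⟨W, rfl⟩ := ρ.exists_rep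
  have := V.irr
  have := W.irr
  have : Invertible (Nat.card K : ℂ) := invertibleOfNonzero (by simp)
  refine (Representation.char_orthonormal V.rep W.rep).trans ?_
  by_cases hn : Nonempty (W.rep.Equiv V.rep)
  · rw [if_pos hn, if_pos (Irr.mk_eq_mk.2 hn).symm]
  · rw [if_neg hn, if_neg fun h => hn (Irr.mk_eq_mk.1 h.symm)]

/-- A finite group has finitely many irreducible representations. -/
instance Irr.instFinite (K : Type u) [Group K] [Finite K] : Finite (Irr K) := by
  classical
  have := Fintype.ofFinite K
  have hli : LinearIndependent ℂ (fun π : Irr K => π.char) := by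
    rw [linearIndependent_iff']
    intro s c hc ρ hρ
    have h0 : ∑ g : K, (∑ π ∈ s, c π • π.char) g * ρ.char g⁻¹ = 0 := by
      rw [hc]
      simp
    have h1 : (Nat.card K : ℂ)⁻¹ * ∑ g : K, (∑ π ∈ s, c π • π.char) g * ρ.char g⁻¹ = c ρ := by
      simp only [Finset.sum_apply, Pi.smul_apply, smul_eq_mul, Finset.sum_mul]
      rw [Finset.sum_comm, Finset.mul_sum]
      have : ∀ π ∈ s, (Nat.card K : ℂ)⁻¹ * ∑ g : K, c π * π.char g * ρ.char g⁻¹ =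
          if π = ρ then c π else 0 := by
        intro π _
        have := Irr.char_orthonormal π ρ
        simp only [mul_assoc, ← Finset.mul_sum]
        rw [mul_left_comm, this]
        simp
      rw [Finset.sum_congr rfl this]
      simp [hρ]
    rw [← h1, h0, mul_zero]
  exact hli.finite

end Irreps

section Particles

variable (G : Type u) [Group G]

variable {G} in
/-- The fixed element of a conjugacy class. -/
noncomputable def classRep (c : ConjClasses G) : G := Quotient.out c

variable {G} in
theorem mk_classRep (c : ConjClasses G) : ConjClasses.mk (classRep c) = c := Quotient.out_eq c

/-- The irreducible representations `(ā, π)` of the quantum double `D(G)`, up to isomorphism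
(the simple objects of `Z(G)`): a conjugacy class `ā` of `G`, the magnetic flux, and an
isomorphism class `π` of irreducible representations of the centralizer `Z(a)` of the fixed
element `a` of `ā`, the electric charge. -/
@[ext]
structure Particle where
  flux : ConjClasses G
  charge : Irr (Subgroup.centralizer ({classRep flux} : Set G))

namespace Particle

variable {G}

/-- The fixed element `a` of the flux `ā` of the particle `(ā, π)`. -/
noncomputable def elt (X : Particle G) : G := classRep X.flux

/-- The centralizer `Z(a)` of the fixed element `a` of the flux. -/
abbrev cent (X : Particle G) : Subgroup G := Subgroup.centralizer ({classRep X.flux} : Set G)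

theorem elt_mem_cent (X : Particle G) : X.elt ∈ X.cent := by
  simp [elt, Subgroup.mem_centralizer_iff]

theorem conj_inv_mem_cent {X Y : Particle G} {h : G} (hh : h * Y.elt * h⁻¹ ∈ X.cent) :
    h * Y.elt⁻¹ * h⁻¹ ∈ X.cent := by
  simpa [mul_assoc] using X.cent.inv_mem hh

theorem inv_conj_mem_cent {X Y : Particle G} {h : G} (hh : h * Y.elt * h⁻¹ ∈ X.cent) :
    h⁻¹ * X.elt⁻¹ * h ∈ Y.cent := by
  have h1 : Commute X.elt (h * Y.elt * h⁻¹) := by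
    have := hh
    rw [Subgroup.mem_centralizer_iff] at this
    exact this _ rfl
  have h2 : Commute (h⁻¹ * X.elt * h) Y.elt := by
    have := (SemiconjBy.conj_iff (b := h⁻¹)).2 h1
    rw [Commute]
    simpa [mul_assoc] using this
  have h3 : h⁻¹ * X.elt⁻¹ * h = (h⁻¹ * X.elt * h)⁻¹ := by group
  rw [h3]
  refine Y.cent.inv_mem ?_
  rw [Subgroup.mem_centralizer_iff]
  intro m hm
  rw [Set.mem_singleton_iff] at hm
  rw [hm]
  exact h2.symm.eq

/-- A chargeon is a particle `(e, π)` with trivial magnetic flux. -/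
def IsChargeon (X : Particle G) : Prop := X.flux = ConjClasses.mk 1

/-- A fluxion is a particle `(ā, 𝟏)` with trivial electric charge. -/
def IsFluxion (X : Particle G) : Prop := X.charge = Irr.trivial X.cent

variable (G) in
/-- The trivial particle `𝟎 = (e, 𝟏)`. -/
noncomputable def vacuum : Particle G where
  flux := ConjClasses.mk 1
  charge := Irr.trivial _

instance instFinite [Finite G] : Finite (Particle G) := by
  have : Finite (ConjClasses G) := inferInstanceAs (Finite (Quotient _))
  refine Finite.of_injective (β := Σ c : ConjClasses G,
    Irr (Subgroup.centralizer ({classRep c} : Set G))) (fun X => ⟨X.flux, X.charge⟩) ?_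
  rintro ⟨c, π⟩ ⟨d, ρ⟩ h
  cases h
  rfl

noncomputable instance instFintype [Finite G] : Fintype (Particle G) := Fintype.ofFinite _

noncomputable instance instDecidableEq : DecidableEq (Particle G) := Classical.decEq _

end Particle

end Particles

section ModularData

variable (G : Type u) [Group G] [Finite G]

open Classical in
/-- The `S`-matrix of `Z(G)`:
`S_{(ā, π)(ā', π')} = 1 / (|Z(a)| |Z(a')|) ∑_{h : h a' h⁻¹ ∈ Z(a)} tr_π(h a'⁻¹ h⁻¹) tr_π'(h⁻¹ a⁻¹ h)`.
-/
noncomputable def S : Matrix (Particle G) (Particle G) ℂ :=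
  letI : Fintype G := Fintype.ofFinite G
  Matrix.of fun X Y =>
    1 / ((Nat.card X.cent : ℂ) * (Nat.card Y.cent : ℂ)) *
      ∑ h : {h : G // h * Y.elt * h⁻¹ ∈ X.cent},
        X.charge.char ⟨h.1 * Y.elt⁻¹ * h.1⁻¹, Particle.conj_inv_mem_cent h.2⟩ *
          Y.charge.char ⟨h.1⁻¹ * X.elt⁻¹ * h.1, Particle.inv_conj_mem_cent h.2⟩

/-- The diagonal `T`-matrix of twist numbers of `Z(G)`: `T_{(ā, π)} = tr_π(a) / tr_π(e)`. -/
noncomputable def T : Matrix (Particle G) (Particle G) ℂ :=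
  Matrix.diagonal fun X => X.charge.char ⟨X.elt, X.elt_mem_cent⟩ / X.charge.char 1

variable {G} in
/-- A modular invariant of `Z(G)`: a matrix that commutes with `S` and `T`, has non-negative
integers as entries, and has entry `1` at the trivial object. -/
structure IsModularInvariant (M : Matrix (Particle G) (Particle G) ℂ) : Prop where
  commute_S : Commute M (S G)
  commute_T : Commute M (T G)
  entries : ∀ X Y, ∃ n : ℕ, M X Y = n
  vacuum : M (Particle.vacuum G) (Particle.vacuum G) = 1

variable {G} in
/-- The permutation matrix of the permutation of the particles that interchanges `C` and `F`. -/
noncomputable def swapMatrix (C F : Particle G) : Matrix (Particle G) (Particle G) ℂ :=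
  (Equiv.swap C F).permMatrix ℂ

end ModularData

end QuantumDouble

/-- A (left) near-field: `(H, +)` is an abelian group, `(H \ 0, *)` is a group,
`0 * x = x * 0 = 0`, and `x * (y + z) = x * y + x * z`. Distributivity from the right is not
assumed. (`inv_zero` and the like in `GroupWithZero` only fix junk values.) -/
class NearField (H : Type u) extends AddCommGroup H, GroupWithZero H where
  mul_add' : ∀ x y z : H, x * (y + z) = x * y + x * z

namespace NearField

variable (H : Type u) [NearField H]

/-- The action of `Hˣ` on `(H, +)` by multiplication from the left. -/
def leftMul : Hˣ →* MulAut (Multiplicative H) where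
  toFun α := AddEquiv.toMultiplicative
    { toFun := fun x => (α : H) * x
      invFun := fun x => ((α⁻¹ : Hˣ) : H) * x
      left_inv := fun x => by simp
      right_inv := fun x => by simp
      map_add' := fun x y => mul_add' _ x y }
  map_one' := by
    ext x
    exact congrArg Multiplicative.ofAdd (one_mul (Multiplicative.toAdd x))
  map_mul' α β := by
    ext x
    exact congrArg Multiplicative.ofAdd (mul_assoc (α : H) β (Multiplicative.toAdd x))

/-- The group `H⁺ ⋊ Hˣ` of pairs `(a, α)` with `(a, α)(b, β) = (a + α b, α β)`. -/
abbrev Semidirect := Multiplicative H ⋊[leftMul H] Hˣ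

theorem semidirect_mul (a b : H) (α β : Hˣ) :
    (⟨Multiplicative.ofAdd a, α⟩ : Semidirect H) * ⟨Multiplicative.ofAdd b, β⟩ =
      ⟨Multiplicative.ofAdd (a + (α : H) * b), α * β⟩ := rfl

instance [Finite H] : Finite (Semidirect H) :=
  Finite.of_injective (β := Multiplicative H × Hˣ) (fun x => (x.left, x.right))
    (fun _ _ h => SemidirectProduct.ext (congrArg Prod.fst h) (congrArg Prod.snd h))

end NearField

/-! Part (i). At a particle `(x, σ)` the row of a chargeon `(e, π)` is `π(x⁻¹) σ(1) / |Z(x)|`.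
Symmetry under the swap makes the rows of `C = (e, π)` and `F = (a, 𝟏)` agree outside `C`, `F`, and
gives `S_CC = S_FF`. Suitable entries rule out that either particle is trivial. The entries at the
chargeons `(e, ρ)`, `ρ ≠ π`, give `π(1) |Z(a)| = |G|` (from `ρ = 𝟏`) and then `ρ(a) = ρ(1)`, so `a`
lies in the common kernel `N` of all irreducibles but `π`. The equality `S_CC = S_FF` says that `a`
commutes with its conjugates. Column orthogonality makes `N \ 1` a single class and `|N| = |Z(a)| =
π(1) + 1`; hence `N = Z(a)` (`exists_mulEquiv_semidirect_of_char`). This `N` is abelian of order one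
more than its index, so it has a complement `K` by Schur–Zassenhaus. Conjugation by `K` is regular
on `N \ 1`, and identifying `k` with `k a k⁻¹` makes `N` a near-field
(`exists_mulEquiv_semidirect`).

Part (ii). `H⁺ ⋊ Hˣ` is doubly transitive on `H`, so its permutation character minus one is an
irreducible `π`, with value `|H| - 1` at the identity, `-1` at the other translations and `0`
elsewhere. The translations are the centralizer of each non-trivial translation `a`, and form one
class apart from the identity. For `C = (e, π)` and `F` with the flux of `a`, orthogonality of
characters gives the equality of rows, and both twists are 1
(`isModularInvariant_swapMatrix_of_char`). -/

namespace QuantumDouble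

/-! ### Kernels of characters, completeness of the irreducible characters, column orthogonality. -/

section CharacterTheory

open scoped MonoidAlgebra

/-- An endomorphism of finite order whose trace is the dimension is the identity. -/
theorem eq_one_of_pow_eq_one_of_trace_eq {V : Type*} [AddCommGroup V] [Module ℂ V]
    [FiniteDimensional ℂ V] {A : Module.End ℂ V} {m : ℕ} (hm : m ≠ 0) (hA : A ^ m = 1)
    (htr : LinearMap.trace ℂ V A = Module.finrank ℂ V) : A = 1 := by
  have hs : A.charpoly.Splits := IsAlgClosed.splits _
  have hcard : A.charpoly.roots.card = Module.finrank ℂ V := by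
    rw [← hs.natDegree_eq_card_roots, LinearMap.charpoly_natDegree]
  rw [Module.End.trace_eq_sum_roots_charpoly_of_splits hs] at htr
  have hnorm : ∀ r ∈ A.charpoly.roots, ‖r‖ = 1 := by
    intro r hr
    have h1 : Module.End.HasEigenvalue A r := by
      rw [Module.End.hasEigenvalue_iff_isRoot_charpoly]
      exact Polynomial.isRoot_of_mem_roots hr
    obtain ⟨v, hv⟩ := h1.exists_hasEigenvector
    have h2 : r ^ m • v = v := by
      rw [← hv.pow_apply, hA, Module.End.one_apply]
    have h3 : r ^ m = 1 := by
      have : (r ^ m - 1) • v = 0 := by rw [sub_smul, h2, one_smul, sub_self]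
      exact sub_eq_zero.1 ((smul_eq_zero.1 this).resolve_right hv.2)
    exact Complex.norm_eq_one_of_pow_eq_one h3 hm
  -- The eigenvalues are roots of unity, so each term `1 - re r` is non-negative; as the terms sum
  -- to zero, all of them vanish.
  have hre : (A.charpoly.roots.map fun r => 1 - r.re).sum = 0 := by
    have h4 := congrArg Complex.re htr
    rw [← Complex.coe_reAddGroupHom, map_multiset_sum] at h4
    rw [Multiset.sum_map_sub, Multiset.map_const', Multiset.sum_replicate, hcard]
    simp only [Complex.coe_reAddGroupHom, Complex.natCast_re] at h4
    simp [h4]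
  have hone : ∀ r ∈ A.charpoly.roots, r = 1 := by
    intro r hr
    have h5 : ∀ x ∈ A.charpoly.roots.map (fun r => 1 - r.re), 0 ≤ x := by
      intro x hx
      obtain ⟨s, hs, rfl⟩ := Multiset.mem_map.1 hx
      have := Complex.re_le_norm s
      rw [hnorm s hs] at this
      linarith
    have h6 := Multiset.single_le_sum h5 _ (Multiset.mem_map_of_mem _ hr)
    rw [hre] at h6
    have h7 := Complex.re_le_norm r
    rw [hnorm r hr] at h7
    have h8 : r.re = 1 := by linarith
    have h9 := Complex.sq_norm r
    rw [hnorm r hr, Complex.normSq_apply, h8] at h9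
    have h10 : r.im = 0 := by nlinarith
    exact Complex.ext (by simpa using h8) (by simpa using h10)
  have hpoly : A.charpoly = (Polynomial.X - Polynomial.C 1) ^ Module.finrank ℂ V := by
    rw [hs.eq_prod_roots_of_monic A.charpoly_monic, Multiset.eq_replicate.2 ⟨hcard, hone⟩]
    simp
  have hnil : IsNilpotent (A - 1) := by
    refine ⟨Module.finrank ℂ V, ?_⟩
    have := A.aeval_self_charpoly
    rw [hpoly] at this
    simpa using this
  -- `X ^ m - 1` is separable, so `A` is diagonalizable, and a nilpotent semisimple `A - 1` is zero.
  have hss : A.IsSemisimple := by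
    refine Module.End.isSemisimple_of_squarefree_aeval_eq_zero
      (p := Polynomial.X ^ m - Polynomial.C 1) ?_ (by simp [hA])
    exact ((Polynomial.separable_X_pow_sub_C (1 : ℂ) (by exact_mod_cast hm)
      one_ne_zero)).squarefree
  have hss' : (A - 1).IsSemisimple := by
    have := (Module.End.isSemisimple_sub_algebraMap_iff (f := A) (μ := (1 : ℂ))).2 hss
    simpa using this
  exact sub_eq_zero.1 (Module.End.eq_zero_of_isNilpotent_isSemisimple hnil hss')

variable {K : Type u} [Group K]

theorem isIrreducible_of_equiv {V W : Type*} [AddCommGroup V] [Module ℂ V] [AddCommGroup W]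
    [Module ℂ W] {ρ : Representation ℂ K V} {σ : Representation ℂ K W} (e : ρ.Equiv σ)
    (h : ρ.IsIrreducible) : σ.IsIrreducible := by
  rw [Representation.irreducible_iff_isSimpleModule_asModule] at h ⊢
  exact IsSimpleModule.congr (LinearEquiv.ofBijective
    (Representation.IntertwiningMap.equivLinearMapAsModule ρ σ e.toIntertwiningMap)
    e.bijective).symm

theorem exists_irr_of_isIrreducible {V : Type*} [AddCommGroup V] [Module ℂ V]
    [FiniteDimensional ℂ V] (ρ : Representation ℂ K V) (h : ρ.IsIrreducible) :
    ∃ π : Irr K, π.char = ρ.character := by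
  let b : V ≃ₗ[ℂ] (Fin (Module.finrank ℂ V) → ℂ) := (Module.finBasis ℂ V).equivFun
  let σ : Representation ℂ K (Fin (Module.finrank ℂ V) → ℂ) :=
    { toFun := fun g => b.conj (ρ g)
      map_one' := by simp [Module.End.one_eq_id]
      map_mul' := fun g h => by rw [map_mul]; exact map_mul b.conjRingEquiv _ _ }
  let e : ρ.Equiv σ := Representation.Equiv.mk b fun g => by
    ext v
    simp [σ, LinearEquiv.conj_apply]
  exact ⟨Irr.mk ⟨_, σ, isIrreducible_of_equiv e h⟩, (Representation.char_iso e).symm⟩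

theorem Irr.exists_char_one (π : Irr K) : ∃ n : ℕ, 0 < n ∧ π.char 1 = n := by
  obtain ⟨V, rfl⟩ := π.exists_rep
  refine ⟨V.dim, ?_, ?_⟩
  · have h := (Representation.irreducible_iff_isSimpleModule_asModule V.rep).1 V.irr
    have : Nontrivial V.rep.asModule := h.nontrivial
    by_contra h0
    have h1 : V.dim = 0 := by omega
    have : Subsingleton (Fin V.dim → ℂ) := by
      have : IsEmpty (Fin V.dim) := by rw [h1]; infer_instance
      infer_instance
    exact not_subsingleton V.rep.asModule this
  · exact (Representation.char_one V.rep).trans (by simp)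

theorem Irr.char_one_ne_zero (π : Irr K) : π.char 1 ≠ 0 := by
  obtain ⟨n, hn, h⟩ := π.exists_char_one
  rw [h]
  exact_mod_cast hn.ne'

theorem Irr.char_conj (π : Irr K) (g h : K) : π.char (h * g * h⁻¹) = π.char g := by
  obtain ⟨V, rfl⟩ := π.exists_rep
  exact Representation.char_conj V.rep g h

theorem Irr.char_eq_of_isConj (π : Irr K) {g h : K} (hgh : IsConj g h) :
    π.char g = π.char h := by
  obtain ⟨c, rfl⟩ := isConj_iff.1 hgh
  rw [π.char_conj]

theorem Irr.char_injective [Finite K] : Function.Injective (Irr.char : Irr K → K → ℂ) := by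
  classical
  intro π ρ h
  have := Fintype.ofFinite K
  have h1 := Irr.char_orthonormal π π
  have h2 := Irr.char_orthonormal π ρ
  rw [← h, h1] at h2
  by_contra hne
  simp [hne] at h2

theorem IrrRep.rep_eq_one_of_char [Finite K] (V : IrrRep K) {g : K}
    (h : (Irr.mk V).char g = (Irr.mk V).char 1) : V.rep g = 1 := by
  refine eq_one_of_pow_eq_one_of_trace_eq (orderOf_pos g).ne' ?_ ?_
  · rw [← map_pow, pow_orderOf_eq_one, map_one]
  · exact h.trans (Representation.char_one V.rep)

/-- An element at which the character takes the value `π(1)` acts as the identity. -/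
theorem Irr.char_mul_of_char_eq [Finite K] (π : Irr K) {g : K} (h : π.char g = π.char 1) (x : K) :
    π.char (g * x) = π.char x := by
  obtain ⟨V, rfl⟩ := π.exists_rep
  have h1 := V.rep_eq_one_of_char h
  change LinearMap.trace ℂ _ (V.rep (g * x)) = LinearMap.trace ℂ _ (V.rep x)
  rw [map_mul, h1, one_mul]

/-- The operator commutes with `ρ`, so it is a scalar by Schur's lemma; its trace is the pairing of
`f` with the character of `ρ`, which vanishes. -/
theorem sum_smul_rep_eq_zero_of_orthogonal [Fintype K] {f : K → ℂ}
    (hf : ∀ g h, f (h * g * h⁻¹) = f g) (horth : ∀ π : Irr K, ∑ g, f g * π.char g = 0)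
    {V : Type*} [AddCommGroup V] [Module ℂ V] [FiniteDimensional ℂ V]
    (ρ : Representation ℂ K V) (hρ : ρ.IsIrreducible) : ∑ g, f g • ρ g = 0 := by
  let φ : ρ.IntertwiningMap ρ :=
    { toLinearMap := ∑ g, f g • ρ g
      isIntertwining' := fun h => by
        change (∑ g, f g • ρ g) * ρ h = ρ h * (∑ g, f g • ρ g)
        rw [Finset.sum_mul, Finset.mul_sum]
        refine Fintype.sum_equiv (MulAut.conj h⁻¹).toEquiv _ _ fun g => ?_
        have h1 : f (MulAut.conj h⁻¹ g) = f g := by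
          rw [MulAut.conj_apply]
          exact hf g h⁻¹
        simp only [MulEquiv.toEquiv_eq_coe, EquivLike.coe_coe, h1, smul_mul_assoc,
          mul_smul_comm, ← map_mul]
        congr 2
        simp [mul_assoc] }
  obtain ⟨c, hc⟩ := Representation.IsIrreducible.algebraMap_intertwiningMap_bijective_of_isAlgClosed
    (ρ := ρ) |>.2 φ
  have hc' : (∑ g, f g • ρ g) = c • (1 : Module.End ℂ V) := by
    have := congrArg Representation.IntertwiningMap.toLinearMap hc
    exact this.symm
  obtain ⟨π, hπ⟩ := exists_irr_of_isIrreducible ρ hρ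
  have h2 := horth π
  have h3 : ∑ g, f g * π.char g = c * π.char 1 := by
    have := congrArg (LinearMap.trace ℂ V) hc'
    simp only [map_sum, map_smul, smul_eq_mul] at this
    rw [hπ]
    simpa [Representation.character] using this
  rw [h3] at h2
  rw [hc', (mul_eq_zero.1 h2).resolve_right π.char_one_ne_zero, zero_smul]

/-- The previous lemma in the language of modules, as needed to exploit the semisimplicity of
`ℂ[K]`. -/
theorem smul_eq_zero_of_orthogonal [Fintype K] {f : K → ℂ}
    (hf : ∀ g h, f (h * g * h⁻¹) = f g) (horth : ∀ π : Irr K, ∑ g, f g * π.char g = 0)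
    (M : Type*) [AddCommGroup M] [Module ℂ[K] M] [Module.Finite ℂ[K] M] [hM : IsSimpleModule ℂ[K] M]
    (x : M) : (∑ g, MonoidAlgebra.single g (f g) : ℂ[K]) • x = 0 := by
  let _ : Module ℂ M := Module.compHom M (algebraMap ℂ ℂ[K])
  have _ : IsScalarTower ℂ ℂ[K] M := IsScalarTower.of_compHom ℂ ℂ[K] M
  have hfin : FiniteDimensional ℂ M := Module.Finite.trans ℂ[K] M
  let ρ : Representation ℂ K M := Representation.ofModule' M
  have hρ : ∀ z : ℂ[K], ρ.asAlgebraHom z = Algebra.lsmul ℂ ℂ M z := fun z =>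
    DFunLike.congr_fun ((MonoidAlgebra.lift ℂ (Module.End ℂ M) K).apply_symm_apply
      (Algebra.lsmul ℂ ℂ M)) z
  have hirr : ρ.IsIrreducible := by
    rw [Representation.irreducible_iff_isSimpleModule_asModule]
    let e : ρ.asModule ≃ₗ[ℂ[K]] M :=
      { ρ.asModuleEquiv with
        map_smul' := fun z x => by
          change ρ.asModuleEquiv (z • x) = z • ρ.asModuleEquiv x
          rw [Representation.asModuleEquiv_map_smul, hρ]
          rfl }
    exact IsSimpleModule.congr e
  have h0 := sum_smul_rep_eq_zero_of_orthogonal hf horth ρ hirr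
  have h1 : ρ.asAlgebraHom (∑ g, MonoidAlgebra.single g (f g)) = 0 := by
    rw [map_sum, ← h0]
    exact Finset.sum_congr rfl fun g _ => ρ.asAlgebraHom_single g (f g)
  rw [hρ] at h1
  exact DFunLike.congr_fun h1 x

/-- A class function that is orthogonal to all irreducible characters vanishes. -/
theorem eq_zero_of_orthogonal [Fintype K] {f : K → ℂ}
    (hf : ∀ g h, f (h * g * h⁻¹) = f g) (horth : ∀ π : Irr K, ∑ g, f g * π.char g = 0) :
    f = 0 := by
  have : NeZero (Nat.card K : ℂ) := ⟨by simp⟩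
  let z : ℂ[K] := ∑ g, MonoidAlgebra.single g (f g)
  have hz : ∀ x : ℂ[K], z * x = x * z := by
    intro x
    induction x using MonoidAlgebra.induction_linear with
    | zero => simp
    | add x y hx hy => rw [mul_add, add_mul, hx, hy]
    | single h r =>
      rw [Finset.sum_mul, Finset.mul_sum]
      refine Fintype.sum_equiv (MulAut.conj h⁻¹).toEquiv _ _ fun g => ?_
      have h1 : f (MulAut.conj h⁻¹ g) = f g := by
        rw [MulAut.conj_apply]
        exact hf g h⁻¹
      simp only [MulEquiv.toEquiv_eq_coe, EquivLike.coe_coe, h1,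
        MonoidAlgebra.single_mul_single, mul_comm]
      congr 1
      simp [mul_assoc]
  -- The annihilator of `z` is a left ideal because `z` is central. It contains every simple
  -- submodule, hence by Maschke everything, in particular 1.
  let N : Submodule ℂ[K] ℂ[K] :=
    { carrier := {x | z * x = 0}
      add_mem' := fun {x y} hx hy => by
        change z * (x + y) = 0
        rw [mul_add, hx, hy, add_zero]
      zero_mem' := mul_zero z
      smul_mem' := fun c x hx => by
        change z * (c * x) = 0
        rw [← mul_assoc, hz c, mul_assoc, hx, mul_zero] }
  have hN : N = ⊤ := by
    rw [eq_top_iff, ← IsSemisimpleModule.sSup_simples_eq_top ℂ[K] ℂ[K]]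
    refine sSup_le fun m hm x hx => ?_
    have : IsSimpleModule ℂ[K] m := hm
    have h3 := smul_eq_zero_of_orthogonal hf horth m ⟨x, hx⟩
    exact congrArg Subtype.val h3
  have h1 : z * 1 = 0 := (hN ▸ Submodule.mem_top : (1 : ℂ[K]) ∈ N)
  rw [mul_one] at h1
  funext g
  classical
  have h2 := congrArg (fun w : ℂ[K] => w.coeff g) h1
  simpa [z, MonoidAlgebra.coeff_sum, Finsupp.single_apply] using h2

/-- A class function is the combination of the irreducible characters given by its inner
products with them. -/
theorem classFunction_eq_sum_char [Fintype K] [Fintype (Irr K)] {f : K → ℂ}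
    (hf : ∀ g h, f (h * g * h⁻¹) = f g) (x : K) :
    f x = ∑ π : Irr K, ((Nat.card K : ℂ)⁻¹ * ∑ g, f g * π.char g⁻¹) * π.char x := by
  classical
  -- The inverses match `eq_zero_of_orthogonal`, which pairs with `π(g)`, to `Irr.char_orthonormal`,
  -- which pairs with `π(g⁻¹)`.
  let F : K → ℂ := fun x => f x⁻¹ -
    ∑ π : Irr K, ((Nat.card K : ℂ)⁻¹ * ∑ g, f g * π.char g⁻¹) * π.char x⁻¹
  have hF : F = 0 := by
    refine eq_zero_of_orthogonal (fun g h => ?_) fun ρ => ?_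
    · have hinv : (h * g * h⁻¹)⁻¹ = h * g⁻¹ * h⁻¹ := by group
      simp only [F, hinv, hf, Irr.char_conj]
    · have h1 : ∑ g, f g⁻¹ * ρ.char g = ∑ g, f g * ρ.char g⁻¹ :=
        Fintype.sum_equiv (Equiv.inv K) _ _ fun g => by simp
      have h2 : ∀ π : Irr K, ∑ g, π.char g⁻¹ * ρ.char g = Nat.card K * if π = ρ then 1 else 0 := by
        intro π
        rw [← Irr.char_orthonormal π ρ, mul_inv_cancel_left₀ (by simp)]
        exact Fintype.sum_equiv (Equiv.inv K) _ _ fun g => by simp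
      simp only [F, sub_mul, Finset.sum_sub_distrib, Finset.sum_mul]
      rw [Finset.sum_comm, h1]
      simp only [mul_assoc, ← Finset.mul_sum, h2]
      have hK : (Nat.card K : ℂ) ≠ 0 := by simp
      simp only [mul_ite, mul_one, mul_zero, Finset.sum_ite_eq', Finset.mem_univ, if_true]
      field_simp
      ring
  have := congrFun hF x⁻¹
  simpa [F, sub_eq_zero] using this

theorem card_isConj_mul_card_centralizer (g : K) :
    Nat.card {x // IsConj g x} * Nat.card (Subgroup.centralizer {g}) = Nat.card K := by
  have h6 := MulAction.index_stabilizer (ConjAct K) g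
  have h7 : MulAction.orbit (ConjAct K) g = {x | IsConj g x} := by
    ext x
    rw [ConjAct.mem_orbit_conjAct, isConj_comm]
    rfl
  have h5 : (Subgroup.centralizer {g}).index = Nat.card {x // IsConj g x} := by
    have h8 := Subgroup.index_comap_of_surjective (f := (ConjAct.toConjAct (G := K)).toMonoidHom)
      (MulAction.stabilizer (ConjAct K) g) ConjAct.toConjAct.surjective
    rw [Subgroup.centralizer_eq_comap_stabilizer]
    refine h8.trans ?_
    rw [h6, h7]
    rfl
  rw [← h5, mul_comm, Subgroup.card_mul_index]

-- Column orthogonality: expand the indicator function of the class of `g` in irreducible characters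
-- and evaluate at `h`.
open Classical in
theorem sum_char_mul_char [Finite K] [Fintype (Irr K)] (g h : K) :
    ∑ π : Irr K, π.char g⁻¹ * π.char h =
      if IsConj g h then (Nat.card (Subgroup.centralizer {g}) : ℂ) else 0 := by
  have := Fintype.ofFinite K
  have hf : ∀ x y, (if IsConj g (y * x * y⁻¹) then (1 : ℂ) else 0) = if IsConj g x then 1 else 0 := by
    intro x y
    have h1 : IsConj x (y * x * y⁻¹) := isConj_iff.2 ⟨y, rfl⟩
    have h2 : IsConj g (y * x * y⁻¹) ↔ IsConj g x := ⟨fun h => h.trans h1.symm, fun h => h.trans h1⟩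
    simp only [h2]
  have h1 := classFunction_eq_sum_char (f := fun x => if IsConj g x then 1 else 0) hf h
  have h2 : ∀ π : Irr K, ∑ x, (if IsConj g x then (1 : ℂ) else 0) * π.char x⁻¹ =
      Nat.card {x // IsConj g x} * π.char g⁻¹ := by
    intro π
    have : ∀ x, (if IsConj g x then (1 : ℂ) else 0) * π.char x⁻¹ =
        if IsConj g x then π.char g⁻¹ else 0 := by
      intro x
      split_ifs with hx
      · obtain ⟨c, rfl⟩ := isConj_iff.1 hx
        have hinv : (c * g * c⁻¹)⁻¹ = c * g⁻¹ * c⁻¹ := by group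
        rw [hinv, π.char_conj, one_mul]
      · rw [zero_mul]
    rw [Finset.sum_congr rfl fun x _ => this x, ← Finset.sum_filter, Finset.sum_const,
      nsmul_eq_mul, Nat.card_eq_fintype_card, Fintype.card_subtype]
  have h3 := card_isConj_mul_card_centralizer g
  simp only [h2] at h1
  have hK : (Nat.card K : ℂ) ≠ 0 := by simp
  have h3' : (Nat.card {x // IsConj g x} : ℂ) * Nat.card (Subgroup.centralizer {g}) = Nat.card K := by
    exact_mod_cast h3
  have hc : (Nat.card {x // IsConj g x} : ℂ) ≠ 0 := left_ne_zero_of_mul (h3' ▸ hK)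
  have h7 : ∑ π : Irr K, π.char g⁻¹ * π.char h =
      (Nat.card (Subgroup.centralizer {g}) : ℂ) * if IsConj g h then 1 else 0 := by
    rw [h1, Finset.mul_sum]
    refine Finset.sum_congr rfl fun π _ => ?_
    rw [← h3']
    have := right_ne_zero_of_mul (h3' ▸ hK)
    field_simp
  rw [h7]
  split_ifs <;> simp

end CharacterTheory

end QuantumDouble

namespace NearField

/-! ### Near-fields from regular actions. -/

section RegularAction

variable {H : Type u} {K : Type*} [AddCommGroup H] [Group K] [DistribMulAction K H] {a : H}

open Classical in
/-- The element of `K` that maps the base point to `x`, for a regular action on `H \ 0`. -/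
noncomputable def coordinate (h : ∀ x : H, x ≠ 0 → ∃! k : K, k • a = x) (x : H) : K :=
  if hx : x = 0 then 1 else (h x hx).choose

theorem coordinate_smul (h : ∀ x : H, x ≠ 0 → ∃! k : K, k • a = x) {x : H} (hx : x ≠ 0) :
    coordinate h x • a = x := by
  rw [coordinate, dif_neg hx]
  exact (h x hx).choose_spec.1

theorem smul_ne_zero_of_ne {x : H} (hx : x ≠ 0) (k : K) : k • x ≠ 0 :=
  fun h0 => hx ((smul_eq_zero_iff_eq k).1 h0)

theorem coordinate_smul_base (h : ∀ x : H, x ≠ 0 → ∃! k : K, k • a = x) (ha : a ≠ 0) (k : K) :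
    coordinate h (k • a) = k :=
  (h _ (smul_ne_zero_of_ne ha k)).unique (coordinate_smul h (smul_ne_zero_of_ne ha k)) rfl

/-- This equivariance yields associativity of the near-field multiplication. -/
theorem coordinate_smul' (h : ∀ x : H, x ≠ 0 → ∃! k : K, k • a = x) (ha : a ≠ 0) (k : K) {x : H}
    (hx : x ≠ 0) : coordinate h (k • x) = k * coordinate h x := by
  conv_lhs => rw [← coordinate_smul h hx, ← mul_smul, coordinate_smul_base h ha]

theorem coordinate_base (h : ∀ x : H, x ≠ 0 → ∃! k : K, k • a = x) (ha : a ≠ 0) :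
    coordinate h a = 1 := by
  have := coordinate_smul_base h ha 1
  rwa [one_smul] at this

open Classical in
/-- A group that acts regularly on the non-zero elements of an abelian group `H` makes `H` a
near-field. -/
@[reducible]
noncomputable def ofRegularAction (ha : a ≠ 0) (h : ∀ x : H, x ≠ 0 → ∃! k : K, k • a = x) :
    NearField H where
  __ := ‹AddCommGroup H›
  -- A non-zero `x` is identified with the element of `K` that carries `a` to `x`. Additivity of the
  -- action gives distributivity in the second factor.
  mul x y := if x = 0 then 0 else coordinate h x • y
  one := a
  inv x := if x = 0 then 0 else (coordinate h x)⁻¹ • a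
  mul_assoc x y z := by
    change (if (if x = 0 then 0 else coordinate h x • y) = 0 then 0
      else coordinate h (if x = 0 then 0 else coordinate h x • y) • z) =
      if x = 0 then 0 else coordinate h x • (if y = 0 then 0 else coordinate h y • z)
    by_cases hx : x = 0
    · simp [hx]
    · by_cases hy : y = 0
      · simp [hy]
      · simp only [if_neg hx, if_neg hy, if_neg (smul_ne_zero_of_ne hy (coordinate h x)),
          coordinate_smul' h ha _ hy, mul_smul]
  one_mul x := by
    change (if a = 0 then 0 else coordinate h a • x) = x
    rw [if_neg ha, coordinate_base h ha, one_smul]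
  mul_one x := by
    change (if x = 0 then 0 else coordinate h x • a) = x
    split_ifs with hx
    · exact hx.symm
    · exact coordinate_smul h hx
  zero_mul x := if_pos rfl
  mul_zero x := by
    change (if x = 0 then 0 else coordinate h x • (0 : H)) = 0
    simp
  exists_pair_ne := ⟨a, 0, ha⟩
  inv_zero := if_pos rfl
  mul_inv_cancel x hx := by
    change (if x = 0 then 0 else coordinate h x • (if x = 0 then 0 else (coordinate h x)⁻¹ • a)) = a
    rw [if_neg hx, if_neg hx, smul_inv_smul]
  mul_add' x y z := by
    change (if x = 0 then 0 else coordinate h x • (y + z)) =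
      (if x = 0 then 0 else coordinate h x • y) + (if x = 0 then 0 else coordinate h x • z)
    split_ifs
    · rw [add_zero]
    · rw [smul_add]

open Classical in
theorem ofRegularAction_mul (ha : a ≠ 0) (h : ∀ x : H, x ≠ 0 → ∃! k : K, k • a = x) (k : K)
    (y : H) : letI := ofRegularAction ha h; (k • a) * y = k • y := by
  change (if k • a = 0 then 0 else coordinate h (k • a) • y) = k • y
  rw [if_neg (smul_ne_zero_of_ne ha k), coordinate_smul_base h ha]

/-- The group of units of the near-field defined by a regular action is the acting group. -/
noncomputable def unitsOfRegularAction (ha : a ≠ 0)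
    (h : ∀ x : H, x ≠ 0 → ∃! k : K, k • a = x) :
    letI := ofRegularAction ha h; K ≃* Hˣ :=
  letI := ofRegularAction ha h
  MulEquiv.ofBijective
    ({ toFun := fun k => Units.mk0 (k • a) (smul_ne_zero_of_ne ha k)
       map_one' := Units.ext (one_smul K a)
       map_mul' := fun k l => Units.ext (by
        change (k * l) • a = (k • a) * (l • a)
        rw [ofRegularAction_mul, mul_smul]) } : K →* Hˣ)
    ⟨fun k l hkl => by
      have h1 : k • a = l • a := congrArg Units.val hkl
      rw [← coordinate_smul_base h ha k, h1, coordinate_smul_base h ha],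
    fun x => ⟨coordinate h (x : H), Units.ext (coordinate_smul h x.ne_zero)⟩⟩

theorem unitsOfRegularAction_mul (ha : a ≠ 0) (h : ∀ x : H, x ≠ 0 → ∃! k : K, k • a = x) (k : K)
    (y : H) : letI := ofRegularAction ha h; (unitsOfRegularAction ha h k : H) * y = k • y :=
  ofRegularAction_mul ha h k y

end RegularAction

/-! ### Groups with a normal subgroup whose non-trivial elements form one class. -/

theorem card_eq_card_isConj_add_one {Γ : Type u} [Group Γ] [Finite Γ] (N : Subgroup Γ)
    [hnormal : N.Normal] {a : Γ} (ha : a ∈ N) (ha1 : a ≠ 1)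
    (hconj : ∀ b ∈ N, b ≠ 1 → IsConj a b) :
    Nat.card N = Nat.card {x // IsConj a x} + 1 := by
  have h4 : (N : Set Γ) = insert 1 {x | IsConj a x} := by
    ext x
    constructor
    · intro hx
      by_cases hx1 : x = 1
      · exact Or.inl hx1
      · exact Or.inr (hconj x hx hx1)
    · rintro (rfl | hx)
      · exact N.one_mem
      · obtain ⟨c, rfl⟩ := isConj_iff.1 hx
        exact hnormal.conj_mem a ha c
  have h5 : (1 : Γ) ∉ {x | IsConj a x} := fun h => ha1 (isConj_one_right.1 h.symm)
  calc Nat.card N = (N : Set Γ).ncard := rfl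
    _ = {x | IsConj a x}.ncard + 1 := by
      rw [h4, Set.ncard_insert_of_notMem h5 (Set.toFinite _)]
    _ = _ := rfl

/-- A finite group with a normal subgroup `N` whose non-trivial elements
form one conjugacy class, with `N` the centralizer of one of them, is the group of affine maps
`x ↦ a + α x` of a near-field. -/
theorem exists_mulEquiv_semidirect {Γ : Type u} [Group Γ] [Finite Γ] (N : Subgroup Γ)
    [hnormal : N.Normal] {a : Γ} (ha : a ∈ N) (ha1 : a ≠ 1) (hconj : ∀ b ∈ N, b ≠ 1 → IsConj a b)
    (hcent : Subgroup.centralizer {a} = N) :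
    ∃ (H : Type u) (_ : NearField H), Finite H ∧ Nonempty (Γ ≃* Semidirect H) := by
  have hcomm1 : ∀ x ∈ N, x * a = a * x := fun x hx => by
    rw [← hcent, Subgroup.mem_centralizer_singleton_iff] at hx
    exact hx
  -- The element `a` is central in its centralizer `N`; conjugation carries this to every
  -- non-trivial element of the normal subgroup `N`.
  have hcomm : ∀ x ∈ N, ∀ y ∈ N, x * y = y * x := by
    intro x hx y hy
    by_cases hy1 : y = 1
    · simp [hy1]
    · obtain ⟨g, rfl⟩ := isConj_iff.1 (hconj y hy hy1)
      have h1 := hcomm1 _ (hnormal.conj_mem x hx g⁻¹)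
      have h2 := congrArg (fun z => g * z * g⁻¹) h1
      simpa [mul_assoc] using h2
  have hcard : Nat.card N = N.index + 1 := by
    have h1 := QuantumDouble.card_isConj_mul_card_centralizer a
    rw [hcent] at h1
    have h2 := N.card_mul_index
    have h3 : N.index = Nat.card {x // IsConj a x} := by
      refine Nat.eq_of_mul_eq_mul_left (Nat.card_pos (α := N)) ?_
      rw [h2, ← h1, mul_comm]
    rw [h3, card_eq_card_isConj_add_one N ha ha1 hconj]
  -- Schur–Zassenhaus: consecutive integers are coprime.
  obtain ⟨K, hK⟩ := Subgroup.exists_right_complement'_of_coprime (N := N) (by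
    rw [hcard]
    simp)
  let _ : CommGroup N :=
    { (inferInstance : Group N) with
      mul_comm := fun x y => Subtype.ext (hcomm x x.2 y y.2) }
  let _ : DistribMulAction K (Additive N) :=
    { smul := fun k x => Additive.ofMul (MulAut.conjNormal (k : Γ) x.toMul)
      one_smul := fun x => by
        change Additive.ofMul (MulAut.conjNormal ((1 : K) : Γ) x.toMul) = x
        simp
      mul_smul := fun k l x => by
        change Additive.ofMul (MulAut.conjNormal ((k * l : K) : Γ) x.toMul) =
          Additive.ofMul (MulAut.conjNormal (k : Γ) (MulAut.conjNormal (l : Γ) x.toMul))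
        simp
      smul_zero := fun k => congrArg Additive.ofMul (map_one (MulAut.conjNormal (k : Γ)))
      smul_add := fun k x y =>
        congrArg Additive.ofMul (map_mul (MulAut.conjNormal (k : Γ)) x.toMul y.toMul) }
  let a' : Additive N := Additive.ofMul ⟨a, ha⟩
  have hsmul : ∀ (k : K) (x : Additive N), ((k • x).toMul : Γ) = k * x.toMul * (k : Γ)⁻¹ :=
    fun k x => rfl
  have ha' : a' ≠ 0 := fun h => ha1 (congrArg (fun x : Additive N => (x.toMul : Γ)) h)
  -- If `g` conjugates `a` to `x`, write `g = k n`; the factor `n` centralizes `a`, so `k` does the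
  -- same. Two such `k` differ by an element of `N ⊓ K = ⊥`.
  have hreg : ∀ x : Additive N, x ≠ 0 → ∃! k : K, k • a' = x := by
    intro x hx
    have hx1 : (x.toMul : Γ) ≠ 1 := fun h => hx (congrArg Additive.ofMul (Subtype.ext h))
    obtain ⟨g, hg⟩ := isConj_iff.1 (hconj _ x.toMul.2 hx1)
    obtain ⟨⟨k, n⟩, hkn⟩ := hK.symm.2 g
    refine ⟨k, ?_, fun l hl => ?_⟩
    · apply Additive.toMul.injective
      apply Subtype.ext
      rw [hsmul, ← hg, ← hkn]
      have := hcomm1 n n.2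
      change (k : Γ) * a * (k : Γ)⁻¹ = (k * n) * a * ((k : Γ) * n)⁻¹
      rw [mul_assoc (k : Γ) n a, this]
      group
    · have h1 : (l : Γ) * a * (l : Γ)⁻¹ = g * a * g⁻¹ := by
        rw [hg, ← hl]
        rfl
      have h2 : (k : Γ)⁻¹ * l ∈ N := by
        have h3 : g⁻¹ * l ∈ N := by
          rw [← hcent, Subgroup.mem_centralizer_singleton_iff]
          have := congrArg (fun z => g⁻¹ * z * l) h1
          simpa [mul_assoc] using this
        have h4 : (k : Γ)⁻¹ * l = n * (g⁻¹ * l) := by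
          rw [← hkn]
          simp [mul_assoc]
        rw [h4]
        exact N.mul_mem n.2 h3
      have h5 : (k : Γ)⁻¹ * l ∈ N ⊓ K := ⟨h2, K.mul_mem (K.inv_mem k.2) l.2⟩
      rw [hK.disjoint.eq_bot, Subgroup.mem_bot] at h5
      exact Subtype.ext (inv_mul_eq_one.1 h5).symm
  refine ⟨Additive N, ofRegularAction ha' hreg, inferInstance, ?_⟩
  let _ := ofRegularAction ha' hreg
  refine ⟨(SemidirectProduct.mulEquivSubgroup hK).symm.trans
    (SemidirectProduct.congr (MulEquiv.toAdditive.symm (AddEquiv.refl (Additive N)))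
      (unitsOfRegularAction ha' hreg) ?_)⟩
  intro k
  ext x
  exact congrArg (fun y : Additive N => (y.toMul : Γ))
    (unitsOfRegularAction_mul ha' hreg k (Additive.ofMul x)).symm

end NearField

namespace QuantumDouble

/-! ### A character-theoretic criterion for affine groups of near-fields. -/

section CharacterCriterion

variable {Γ : Type u} [Group Γ] [Finite Γ]

/-- The common kernel of the irreducible representations other than `π`. -/
def kernelOfOthers (π : Irr Γ) : Subgroup Γ where
  carrier := {g | ∀ ρ : Irr Γ, ρ ≠ π → ρ.char g = ρ.char 1}
  mul_mem' := fun {g h} hg hh ρ hρ => by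
    rw [ρ.char_mul_of_char_eq (hg ρ hρ), hh ρ hρ]
  one_mem' := fun _ _ => rfl
  inv_mem' := fun {g} hg ρ hρ => by
    rw [← ρ.char_mul_of_char_eq (hg ρ hρ), mul_inv_cancel]

instance (π : Irr Γ) : (kernelOfOthers π).Normal where
  conj_mem := fun g hg h ρ hρ => by rw [ρ.char_conj, hg ρ hρ]

/-- Elements of `N = kernelOfOthers π` are told apart by `π` alone, and column orthogonality with 1
gives `π` the same value on all of `N \ 1`. Distinct classes have orthogonal columns, so `N \ 1` is
one class. Counting then gives `|N| = |Z(a)|`. -/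
theorem exists_mulEquiv_semidirect_of_char (π : Irr Γ) {a : Γ} (ha1 : a ≠ 1)
    (hdim : π.char 1 * Nat.card (Subgroup.centralizer {a}) = Nat.card Γ)
    (hcomm : ∀ g : Γ, g * a * g⁻¹ ∈ Subgroup.centralizer {a})
    (hker : ∀ ρ : Irr Γ, ρ ≠ π → ρ.char a = ρ.char 1) :
    ∃ (H : Type u) (_ : NearField H), Finite H ∧ Nonempty (Γ ≃* NearField.Semidirect H) := by
  classical
  have := Fintype.ofFinite (Irr Γ)
  let N := kernelOfOthers π
  have ha : a ∈ N := hker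
  set d := π.char 1 with hd
  have hd0 : d ≠ 0 := π.char_one_ne_zero
  set z : ℂ := (Nat.card (Subgroup.centralizer {a}) : ℂ) with hz
  have hz0 : z ≠ 0 := Nat.cast_ne_zero.2 Nat.card_pos.ne'
  set m : ℂ := ∑ ρ ∈ Finset.univ.erase π, ρ.char 1 * ρ.char 1 with hm
  have hsplit : ∀ f : Irr Γ → ℂ, ∑ ρ, f ρ = ∑ ρ ∈ Finset.univ.erase π, f ρ + f π := fun f =>
    (Finset.sum_erase_add _ _ (Finset.mem_univ π)).symm
  have hcard : m + d * d = Nat.card Γ := by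
    have h := sum_char_mul_char (1 : Γ) 1
    rw [if_pos (IsConj.refl _), inv_one, hsplit] at h
    rw [hm, hd, h, Subgroup.centralizer_eq_top_iff_subset.2 (by simp), Subgroup.card_top]
  have hval : ∀ b ∈ N, b ≠ 1 → m + d * π.char b = 0 := by
    intro b hb hb1
    have h := sum_char_mul_char (1 : Γ) b
    rw [if_neg (fun h => hb1 (isConj_one_right.1 h)), inv_one, hsplit] at h
    rw [← h]
    congr 1
    exact Finset.sum_congr rfl fun ρ hρ => by rw [hb ρ (Finset.ne_of_mem_erase hρ)]
  have hval' : ∀ b ∈ N, b ≠ 1 → π.char b = π.char a := fun b hb hb1 =>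
    mul_left_cancel₀ hd0 (add_left_cancel ((hval b hb hb1).trans (hval a ha ha1).symm))
  have hzsum : ∑ ρ : Irr Γ, ρ.char a⁻¹ * ρ.char a = z := by
    rw [sum_char_mul_char, if_pos (IsConj.refl _)]
  have hconj : ∀ b ∈ N, b ≠ 1 → IsConj a b := by
    intro b hb hb1
    by_contra hab
    have h := sum_char_mul_char a b
    rw [if_neg hab] at h
    apply hz0
    rw [← hzsum, ← h]
    refine Finset.sum_congr rfl fun ρ _ => ?_
    by_cases hρ : ρ = π
    · rw [hρ, hval' b hb hb1]
    · rw [hb ρ hρ, hker ρ hρ]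
  -- With `c = π(a)`, the relations `m + d c = 0`, `m + c² = z` and `d z = m + d²` give `z = d - c`
  -- and `(d - c)(c + 1) = 0`; since `z ≠ 0`, `c = -1`.
  have hz1 : z = d + 1 := by
    have h1 : m + π.char a * π.char a = z := by
      rw [← hzsum, hsplit, hval' a⁻¹ (N.inv_mem ha) (inv_ne_one.2 ha1)]
      congr 1
      refine Finset.sum_congr rfl fun ρ hρ => ?_
      rw [hker ρ (Finset.ne_of_mem_erase hρ),
        (N.inv_mem ha : a⁻¹ ∈ N) ρ (Finset.ne_of_mem_erase hρ)]
    have h2 := hval a ha ha1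
    have h3 : d * z = m + d * d := hdim.trans hcard.symm
    set c := π.char a
    have h4 : z = d - c := mul_left_cancel₀ hd0 (by linear_combination h3 + h2)
    have h5 : (d - c) * (c + 1) = 0 := by linear_combination h2 - h1 - h4
    have h6 : c = -1 := eq_neg_of_add_eq_zero_left ((mul_eq_zero.1 h5).resolve_left (h4 ▸ hz0))
    rw [h4, h6]
    ring
  have hN : Nat.card N = Nat.card (Subgroup.centralizer {a}) := by
    have h1 := card_isConj_mul_card_centralizer a
    have h2 : (Nat.card {x // IsConj a x} : ℂ) = d := by
      refine mul_right_cancel₀ hz0 ?_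
      rw [hdim, ← h1]
      push_cast
      rfl
    have h3 : (Nat.card N : ℂ) = z := by
      rw [NearField.card_eq_card_isConj_add_one N ha ha1 hconj, hz1, ← h2]
      push_cast
      rfl
    exact Nat.cast_injective (R := ℂ) h3
  have hle : N ≤ Subgroup.centralizer {a} := by
    intro b hb
    by_cases hb1 : b = 1
    · rw [hb1]
      exact Subgroup.one_mem _
    · obtain ⟨g, rfl⟩ := isConj_iff.1 (hconj b hb hb1)
      exact hcomm g
  exact NearField.exists_mulEquiv_semidirect N ha ha1 hconj
    (Subgroup.eq_of_le_of_card_ge hle hN.symm.le).symm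

end CharacterCriterion

/-! ### The `S`-matrix on chargeons and fluxions. -/

section SMatrix

variable {G : Type u} [Group G]

theorem mem_cent_iff (X : Particle G) (g : G) : g ∈ X.cent ↔ g * X.elt = X.elt * g :=
  Subgroup.mem_centralizer_singleton_iff

theorem inv_mul_mem_cent_iff (X Y : Particle G) (h : G) :
    h⁻¹ * X.elt * h⁻¹⁻¹ ∈ Y.cent ↔ h * Y.elt * h⁻¹ ∈ X.cent := by
  rw [mem_cent_iff, mem_cent_iff, inv_inv]
  constructor
  · intro e
    have := congrArg (fun x => h * x * h⁻¹) e
    simpa [mul_assoc] using this.symm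
  · intro e
    have := congrArg (fun x => h⁻¹ * x * h) e
    simpa [mul_assoc] using this.symm

theorem classRep_one : classRep (ConjClasses.mk (1 : G)) = 1 :=
  isConj_one_right.1 (ConjClasses.mk_eq_mk_iff_isConj.1 (mk_classRep (ConjClasses.mk (1 : G)))).symm

theorem elt_eq_one_iff (X : Particle G) : X.elt = 1 ↔ X.IsChargeon := by
  constructor
  · intro h
    rw [Particle.IsChargeon, ← h]
    exact (mk_classRep X.flux).symm
  · intro h
    rw [Particle.elt, h, classRep_one]

namespace Particle

theorem vacuum_isChargeon : (vacuum G).IsChargeon := rfl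

theorem vacuum_isFluxion : (vacuum G).IsFluxion := rfl

theorem IsChargeon.mem_cent {X : Particle G} (hX : X.IsChargeon) (g : G) : g ∈ X.cent := by
  rw [mem_cent_iff, (elt_eq_one_iff X).2 hX, mul_one, one_mul]

theorem IsChargeon.card_cent {X : Particle G} (hX : X.IsChargeon) :
    Nat.card X.cent = Nat.card G := by
  rw [(Subgroup.eq_top_iff' _).2 hX.mem_cent, Subgroup.card_top]

end Particle

variable [Finite G]

theorem commute_swapMatrix_iff (C F : Particle G) (M : Matrix (Particle G) (Particle G) ℂ) :
    Commute (swapMatrix C F) M ↔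
      ∀ X Y, M (Equiv.swap C F X) (Equiv.swap C F Y) = M X Y := by
  have h1 : swapMatrix C F * M = M.submatrix (Equiv.swap C F) id := by
    rw [swapMatrix, Equiv.Perm.permMatrix, PEquiv.toMatrix_toPEquiv_mul]
  have h2 : M * swapMatrix C F = M.submatrix id (Equiv.swap C F) := by
    rw [swapMatrix, Equiv.Perm.permMatrix, PEquiv.mul_toMatrix_toPEquiv, Equiv.symm_swap]
  rw [Commute, SemiconjBy, h1, h2, ← Matrix.ext_iff]
  constructor
  · intro h X Y
    have := h X (Equiv.swap C F Y)
    simpa using this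
  · intro h X Y
    have := h X (Equiv.swap C F Y)
    simpa using this

theorem S_apply (X Y : Particle G) [Fintype {h : G // h * Y.elt * h⁻¹ ∈ X.cent}] :
    S G X Y = 1 / ((Nat.card X.cent : ℂ) * (Nat.card Y.cent : ℂ)) *
      ∑ h : {h : G // h * Y.elt * h⁻¹ ∈ X.cent},
        X.charge.char ⟨h.1 * Y.elt⁻¹ * h.1⁻¹, Particle.conj_inv_mem_cent h.2⟩ *
          Y.charge.char ⟨h.1⁻¹ * X.elt⁻¹ * h.1, Particle.inv_conj_mem_cent h.2⟩ := by
  rw [S, Matrix.of_apply]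
  congr!

/-- Substituting `h⁻¹` for `h` exchanges the two characters. -/
theorem S_symm (X Y : Particle G) : S G X Y = S G Y X := by
  classical
  have := Fintype.ofFinite G
  rw [S_apply, S_apply, mul_comm (Nat.card X.cent : ℂ)]
  congr 1
  refine Fintype.sum_equiv
    ((Equiv.inv G).subtypeEquiv fun h => (inv_mul_mem_cent_iff X Y h).symm) _ _ fun h => ?_
  rw [mul_comm]
  congr 3
  · change _ = h.1⁻¹ * X.elt⁻¹ * h.1⁻¹⁻¹
    rw [inv_inv]
  · change _ = h.1⁻¹⁻¹ * Y.elt⁻¹ * h.1⁻¹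
    rw [inv_inv]

namespace Particle

/-- The flux of `C` is trivial, so every `h` in `G` contributes, and always the same term. -/
theorem IsChargeon.S_apply {C : Particle G} (hC : C.IsChargeon) (X : Particle G) :
    S G C X = C.charge.char ⟨X.elt⁻¹, hC.mem_cent _⟩ * X.charge.char 1 / Nat.card X.cent := by
  classical
  have := Fintype.ofFinite G
  have hG : (Nat.card G : ℂ) ≠ 0 := by simp
  have hz : (Nat.card X.cent : ℂ) ≠ 0 := by simp
  have h1 : ∀ h : {h : G // h * X.elt * h⁻¹ ∈ C.cent},
      C.charge.char ⟨h.1 * X.elt⁻¹ * h.1⁻¹, conj_inv_mem_cent h.2⟩ *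
          X.charge.char ⟨h.1⁻¹ * C.elt⁻¹ * h.1, inv_conj_mem_cent h.2⟩ =
        C.charge.char ⟨X.elt⁻¹, hC.mem_cent _⟩ * X.charge.char 1 := by
    intro h
    congr 1
    · exact C.charge.char_conj ⟨X.elt⁻¹, hC.mem_cent _⟩ ⟨h.1, hC.mem_cent _⟩
    · congr 1
      apply Subtype.ext
      simp [(elt_eq_one_iff C).2 hC]
  have h2 : Fintype.card {h : G // h * X.elt * h⁻¹ ∈ C.cent} = Nat.card G := by
    rw [Nat.card_eq_fintype_card]
    exact Fintype.card_congr (Equiv.subtypeUnivEquiv fun h => hC.mem_cent _)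
  rw [QuantumDouble.S_apply, Finset.sum_congr rfl fun h _ => h1 h, Finset.sum_const, nsmul_eq_mul,
    Finset.card_univ, h2, hC.card_cent]
  field_simp

theorem IsFluxion.S_apply {F : Particle G} (hF : F.IsFluxion) (X : Particle G)
    [Fintype {h : G // h * X.elt * h⁻¹ ∈ F.cent}] :
    S G F X = 1 / ((Nat.card F.cent : ℂ) * (Nat.card X.cent : ℂ)) *
      ∑ h : {h : G // h * X.elt * h⁻¹ ∈ F.cent},
        X.charge.char ⟨h.1⁻¹ * F.elt⁻¹ * h.1, inv_conj_mem_cent h.2⟩ := by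
  rw [QuantumDouble.S_apply]
  congr 1
  refine Finset.sum_congr rfl fun h _ => ?_
  rw [IsFluxion] at hF
  rw [hF, Irr.char_trivial, one_mul]

end Particle

end SMatrix

/-! ### From a symmetry of `S` to a near-field. -/

section NearFieldOfSymmetry

variable {G : Type u} [Group G]

theorem Particle.IsChargeon.char_inv_elt {C : Particle G} (hC : C.IsChargeon) :
    C.charge.char ⟨C.elt⁻¹, hC.mem_cent _⟩ = C.charge.char 1 := by
  congr 1
  apply Subtype.ext
  simp [(elt_eq_one_iff C).2 hC]

theorem Particle.IsFluxion.char_eq_one {F : Particle G} (hF : F.IsFluxion) (g : F.cent) :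
    F.charge.char g = 1 := by
  rw [Particle.IsFluxion] at hF
  rw [hF, Irr.char_trivial]

theorem Particle.IsChargeon.char_eq_of_isConj {C : Particle G} (hC : C.IsChargeon) {g h : G}
    (hgh : IsConj g h) :
    C.charge.char ⟨g, hC.mem_cent g⟩ = C.charge.char ⟨h, hC.mem_cent h⟩ := by
  obtain ⟨c, rfl⟩ := isConj_iff.1 hgh
  exact Irr.char_eq_of_isConj _ (isConj_iff.2 ⟨⟨c, hC.mem_cent c⟩, rfl⟩)

variable [Finite G]

theorem Particle.IsChargeon.eq_of_isFluxion {C F : Particle G} (hC : C.IsChargeon)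
    (hF : F.IsChargeon) (hF' : F.IsFluxion) (h : ∀ g : G, C.charge.char ⟨g, hC.mem_cent g⟩ = 1) :
    C = F := by
  obtain ⟨c, π⟩ := C
  obtain ⟨f, ρ⟩ := F
  obtain rfl : c = ConjClasses.mk 1 := hC
  obtain rfl : f = ConjClasses.mk 1 := hF
  congr 1
  rw [Particle.IsFluxion] at hF'
  refine Irr.char_injective (funext fun g => ?_)
  simp only at hF'
  rw [hF', Irr.char_trivial]
  exact h g

/-- A chargeon is not interchanged with the trivial particle. -/
theorem eq_of_S_swap_vacuum {C F : Particle G} (hC : C.IsChargeon) (hF : F.IsChargeon)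
    (hF' : F.IsFluxion) (hCC : S G C C = S G F F)
    (hX : ∀ X, X ≠ C → X ≠ F → S G C X = S G F X) : C = F := by
  have hG : (Nat.card G : ℂ) ≠ 0 := Nat.cast_ne_zero.2 Nat.card_pos.ne'
  refine hC.eq_of_isFluxion hF hF' fun g => ?_
  -- At the identity, `S_CC = S_FF` reads `π(1)² = 1`. Elsewhere the rows are compared at the
  -- fluxion with the class of `g⁻¹`, inverted because `S` evaluates `π` at inverses.
  by_cases hg : g = 1
  · subst hg
    rw [hC.S_apply, hF.S_apply, hC.char_inv_elt, hF.char_inv_elt, hC.card_cent, hF.card_cent,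
      hF'.char_eq_one, div_left_inj' hG] at hCC
    obtain ⟨n, -, hn⟩ := C.charge.exists_char_one
    change C.charge.char 1 = 1
    rw [hn] at hCC ⊢
    have h1 : n * n = 1 * 1 := by exact_mod_cast hCC
    rw [Nat.mul_self_inj.1 h1, Nat.cast_one]
  · let X : Particle G := ⟨ConjClasses.mk g⁻¹, Irr.trivial _⟩
    have hconj : IsConj X.elt g⁻¹ := ConjClasses.mk_eq_mk_iff_isConj.1 (mk_classRep X.flux)
    have hX1 : ¬ X.IsChargeon := fun h => by
      rw [(elt_eq_one_iff X).2 h, isConj_one_right, inv_eq_one] at hconj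
      exact hg hconj
    have h1 := hX X (fun h => hX1 (h ▸ hC)) (fun h => hX1 (h ▸ hF))
    have hz : (Nat.card X.cent : ℂ) ≠ 0 := Nat.cast_ne_zero.2 Nat.card_pos.ne'
    rw [hC.S_apply, hF.S_apply, hF'.char_eq_one, div_left_inj' hz,
      mul_left_inj' X.charge.char_one_ne_zero] at h1
    rw [← h1]
    refine hC.char_eq_of_isConj ?_
    obtain ⟨c, hc⟩ := isConj_iff.1 hconj
    refine isConj_iff.2 ⟨c⁻¹, ?_⟩
    rw [← inv_inj, inv_inv X.elt, mul_inv_rev, mul_inv_rev, ← hc]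
    group

/-- A fluxion is not interchanged with the trivial particle. -/
theorem isChargeon_of_S_swap_vacuum {C F : Particle G} (hC : C.IsChargeon) (hC' : C.IsFluxion)
    (hF' : F.IsFluxion) (hX : ∀ X, X ≠ C → X ≠ F → S G C X = S G F X) : F.IsChargeon := by
  classical
  by_contra hF
  have := Fintype.ofFinite (Irr C.cent)
  have hG : (Nat.card G : ℂ) ≠ 0 := Nat.cast_ne_zero.2 Nat.card_pos.ne'
  have hz : (Nat.card F.cent : ℂ) ≠ 0 := Nat.cast_ne_zero.2 Nat.card_pos.ne'
  let b : C.cent := ⟨F.elt⁻¹, hC.mem_cent _⟩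
  have hb : b ≠ 1 := fun h => hF ((elt_eq_one_iff F).1 (inv_eq_one.1 (congrArg Subtype.val h)))
  have hsum := sum_char_mul_char (1 : C.cent) b
  rw [if_neg (fun h => hb (isConj_one_right.1 h)), inv_one] at hsum
  choose n hn0 hn using fun ρ : Irr C.cent => ρ.exists_char_one
  -- Comparison at the chargeons `(e, ρ)` makes every `ρ(b)` positive, which contradicts the
  -- orthogonality of the columns of 1 and `b`.
  have hρ : ∀ ρ : Irr C.cent, ρ ≠ Irr.trivial _ →
      (Nat.card G : ℂ) * ρ.char b = Nat.card F.cent * n ρ := by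
    intro ρ hρ
    let X : Particle G := ⟨C.flux, ρ⟩
    have hXc : X.IsChargeon := hC
    have h1 := hX X (fun h => hρ (by
      rw [Particle.IsFluxion] at hC'
      rw [← hC']
      have := (Particle.ext_iff.1 h).2
      exact eq_of_heq this)) (fun h => hF (h ▸ hXc))
    rw [S_symm F, hC.S_apply, hXc.S_apply, hC'.char_eq_one, hF'.char_eq_one, hXc.card_cent,
      one_mul, mul_one, div_eq_div_iff hG hz] at h1
    have h2 : X.charge.char 1 = n ρ := hn ρ
    have h3 : X.charge.char ⟨F.elt⁻¹, hXc.mem_cent _⟩ = ρ.char b := rfl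
    rw [h2, h3] at h1
    linear_combination -h1
  have h0 : (Nat.card G : ℂ) + ∑ ρ ∈ Finset.univ.erase (Irr.trivial C.cent),
      (n ρ : ℂ) * (Nat.card F.cent * n ρ) = 0 := by
    have h1 := congrArg (fun x => (Nat.card G : ℂ) * x) hsum
    simp only [mul_zero] at h1
    rw [Finset.mul_sum, ← Finset.add_sum_erase _ _ (Finset.mem_univ (Irr.trivial C.cent)),
      Irr.char_trivial, Irr.char_trivial, mul_one, mul_one] at h1
    rw [← h1]
    congr 1
    refine Finset.sum_congr rfl fun ρ hρ' => ?_
    rw [← hρ ρ (Finset.ne_of_mem_erase hρ'), hn ρ]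
    ring
  have h1 : Nat.card G + ∑ ρ ∈ Finset.univ.erase (Irr.trivial C.cent),
      n ρ * (Nat.card F.cent * n ρ) = 0 := by
    exact_mod_cast h0
  have := Nat.card_pos (α := G)
  omega

/-- If the interchange of a chargeon and a fluxion is a symmetry of the `S`-matrix of `G`, then `G`
is the group of affine maps of a near-field. -/
theorem exists_nearField_of_commute_S {C F : Particle G} (hC : C.IsChargeon) (hF' : F.IsFluxion)
    (hne : C ≠ F) (hS : Commute (swapMatrix C F) (S G)) :
    ∃ (H : Type u) (_ : NearField H), Finite H ∧ Nonempty (G ≃* NearField.Semidirect H) := by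
  classical
  have := Fintype.ofFinite G
  rw [commute_swapMatrix_iff] at hS
  have hX : ∀ X, X ≠ C → X ≠ F → S G C X = S G F X := by
    intro X h1 h2
    have := hS F X
    rwa [Equiv.swap_apply_right, Equiv.swap_apply_of_ne_of_ne h1 h2] at this
  have hCC : S G C C = S G F F := by
    have := hS F F
    rwa [Equiv.swap_apply_right] at this
  have hF : ¬ F.IsChargeon := fun hF => hne (eq_of_S_swap_vacuum hC hF hF' hCC hX)
  have hC' : ¬ C.IsFluxion := fun hC' => hF (isChargeon_of_S_swap_vacuum hC hC' hF' hX)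
  have hG : (Nat.card G : ℂ) ≠ 0 := Nat.cast_ne_zero.2 Nat.card_pos.ne'
  have hz : (Nat.card F.cent : ℂ) ≠ 0 := Nat.cast_ne_zero.2 Nat.card_pos.ne'
  let a : C.cent := ⟨F.elt, hC.mem_cent _⟩
  have ha1 : a ≠ 1 := fun h => hF ((elt_eq_one_iff F).1 (congrArg Subtype.val h))
  have hρ : ∀ ρ : Irr C.cent, ρ ≠ C.charge →
      C.charge.char 1 * ρ.char 1 * Nat.card F.cent = ρ.char a⁻¹ * Nat.card G := by
    intro ρ hρ
    let X : Particle G := ⟨C.flux, ρ⟩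
    have hXc : X.IsChargeon := hC
    have h1 := hX X (fun h => hρ (eq_of_heq (Particle.ext_iff.1 h).2)) (fun h => hF (h ▸ hXc))
    rw [S_symm F, hC.S_apply, hXc.S_apply, hF'.char_eq_one, hXc.card_cent, mul_one,
      div_eq_div_iff hG hz] at h1
    have h4 : C.charge.char ⟨X.elt⁻¹, hC.mem_cent _⟩ = C.charge.char 1 := hC.char_inv_elt
    rw [h4] at h1
    exact h1
  -- The trivial `ρ` is allowed because `C` is not a fluxion.
  have hdim : C.charge.char 1 * Nat.card F.cent = Nat.card G := by
    have h1 := hρ (Irr.trivial _) (fun h => hC' h.symm)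
    rwa [Irr.char_trivial, Irr.char_trivial, mul_one, one_mul] at h1
  have hker : ∀ ρ : Irr C.cent, ρ ≠ C.charge → ρ.char a = ρ.char 1 := by
    intro ρ h
    have h1 : ρ.char a⁻¹ = ρ.char 1 := by
      refine mul_right_cancel₀ hG ?_
      rw [← hρ ρ h, ← hdim]
      ring
    rw [← ρ.char_mul_of_char_eq h1 a, inv_mul_cancel]
  -- By `hdim`, `S_CC = S_FF` says that the number of `h` with `h a h⁻¹ ∈ Z(a)` is `|G|`, so no `h`
  -- fails.
  have hcomm : ∀ g : G, g * F.elt * g⁻¹ ∈ F.cent := by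
    rw [hC.S_apply, hC.char_inv_elt, hC.card_cent, hF'.S_apply,
      Finset.sum_congr rfl fun h _ => hF'.char_eq_one _, Finset.sum_const, Finset.card_univ,
      nsmul_eq_mul, mul_one, one_div, inv_mul_eq_div, div_eq_div_iff hG (mul_ne_zero hz hz)] at hCC
    have h1 : (Nat.card G : ℂ) * Nat.card G =
        Fintype.card {h : G // h * F.elt * h⁻¹ ∈ F.cent} * Nat.card G := by
      rw [← hCC]
      nth_rw 1 [← hdim]
      nth_rw 1 [← hdim]
      ring
    have h2 := Nat.cast_injective (mul_right_cancel₀ hG h1)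
    rw [Nat.card_eq_fintype_card] at h2
    intro g
    by_contra hg
    exact (Fintype.card_subtype_lt (p := fun h : G => h * F.elt * h⁻¹ ∈ F.cent) hg).ne h2.symm
  -- The charge of `C` is a representation of `C.cent`, a copy of `G`; the criterion is applied to
  -- that copy.
  have hcard : Nat.card (Subgroup.centralizer ({a} : Set C.cent)) = Nat.card F.cent := by
    refine Nat.card_congr
      { toFun := fun x => ⟨x.1.1, (mem_cent_iff F _).2
          (congrArg Subtype.val (Subgroup.mem_centralizer_singleton_iff.1 x.2))⟩
        invFun := fun y => ⟨⟨y.1, hC.mem_cent _⟩, Subgroup.mem_centralizer_singleton_iff.2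
          (Subtype.ext ((mem_cent_iff F _).1 y.2))⟩
        left_inv := fun _ => rfl
        right_inv := fun _ => rfl }
  obtain ⟨H, hH, hfin, ⟨e⟩⟩ := exists_mulEquiv_semidirect_of_char C.charge ha1
    (by rw [hcard, hdim, hC.card_cent])
    (fun g => Subgroup.mem_centralizer_singleton_iff.2
      (Subtype.ext ((mem_cent_iff F _).1 (hcomm g)))) hker
  let e' : C.cent ≃* G :=
    MulEquiv.ofBijective C.cent.subtype ⟨C.cent.subtype_injective, fun g => ⟨⟨g, hC.mem_cent g⟩, rfl⟩⟩
  exact ⟨H, hH, hfin, ⟨e'.symm.trans e⟩⟩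

end NearFieldOfSymmetry

/-! ### Irreducible characters of doubly transitive actions. -/

section PermutationCharacter

variable {K : Type u} [Group K] {Ω : Type*}

/-- The representation of `K` on the functions on a `K`-set. -/
def permRep (φ : K →* Equiv.Perm Ω) : Representation ℂ K (Ω → ℂ) where
  toFun g := LinearMap.funLeft ℂ ℂ (φ g⁻¹)
  map_one' := by
    ext f x
    simp
  map_mul' g h := by
    ext f x
    simp

theorem permRep_apply (φ : K →* Equiv.Perm Ω) (g : K) (f : Ω → ℂ) (x : Ω) :
    permRep φ g f x = f (φ g⁻¹ x) := rfl

variable [Fintype Ω]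

theorem sum_permRep (φ : K →* Equiv.Perm Ω) (g : K) (f : Ω → ℂ) :
    ∑ x, permRep φ g f x = ∑ x, f x :=
  Fintype.sum_equiv (φ g⁻¹) _ _ fun _ => rfl

/-- The functions of sum zero on a `K`-set. -/
def sumZero (φ : K →* Equiv.Perm Ω) : Subrepresentation (permRep φ) where
  toSubmodule :=
    { carrier := {f | ∑ x, f x = 0}
      add_mem' := fun {f g} hf hg => by
        simp only [Set.mem_ofPred_eq, Pi.add_apply, Finset.sum_add_distrib] at *
        rw [hf, hg, add_zero]
      zero_mem' := by simp
      smul_mem' := fun c f hf => by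
        simp only [Set.mem_ofPred_eq, Pi.smul_apply, smul_eq_mul, ← Finset.mul_sum] at *
        rw [hf, mul_zero] }
  apply_mem_toSubmodule g f hf := (sum_permRep φ g f).trans hf

theorem mem_sumZero (φ : K →* Equiv.Perm Ω) (f : Ω → ℂ) :
    f ∈ (sumZero φ).toSubmodule ↔ ∑ x, f x = 0 := Iff.rfl

/-- Averaging a non-zero `f ∈ W` over the stabilizer of a point `x` with `f x ≠ 0` gives a function
constant off `x`, thus a constant plus a multiple of the delta function at `x`. Its translates span
the functions of sum zero. -/
theorem sumZero_le_of_ne_bot [Fintype K] {φ : K →* Equiv.Perm Ω}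
    (htrans : ∀ x y z w : Ω, x ≠ y → z ≠ w → ∃ g, φ g x = z ∧ φ g y = w)
    {W : Submodule ℂ (Ω → ℂ)} (hW : W ≤ (sumZero φ).toSubmodule)
    (hinv : ∀ g, ∀ f ∈ W, permRep φ g f ∈ W) (hne : W ≠ ⊥) : (sumZero φ).toSubmodule ≤ W := by
  classical
  obtain ⟨f, hf, hf0⟩ := W.ne_bot_iff.1 hne
  obtain ⟨x, hx⟩ := Function.ne_iff.1 hf0
  let s : Finset K := Finset.univ.filter fun g => φ g x = x
  let F : Ω → ℂ := ∑ g ∈ s, permRep φ g f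
  have hFW : F ∈ W := W.sum_mem fun g _ => hinv g f hf
  have hF : ∀ y, F y = ∑ g ∈ s, f (φ g⁻¹ y) := fun y => by
    simp only [F, Finset.sum_apply, permRep_apply]
  have hs : ∀ {g}, g ∈ s ↔ φ g x = x := by simp [s]
  have hFx : F x ≠ 0 := by
    have h1 : ∀ g ∈ s, f (φ g⁻¹ x) = f x := fun g hg => by
      rw [map_inv, Equiv.Perm.inv_eq_iff_eq.2 (hs.1 hg).symm]
    rw [hF, Finset.sum_congr rfl h1, Finset.sum_const, nsmul_eq_mul]
    refine mul_ne_zero (Nat.cast_ne_zero.2 (Finset.card_pos.2 ⟨1, ?_⟩).ne') hx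
    simp [s]
  -- Double transitivity supplies `k` that fixes `x` and carries `y` to `z`; the average over the
  -- stabilizer absorbs `k`.
  have hconst : ∀ y z, y ≠ x → z ≠ x → F y = F z := by
    intro y z hy hz
    obtain ⟨k, hk1, hk2⟩ := htrans x y x z hy.symm hz.symm
    rw [hF, hF]
    refine Finset.sum_bij (fun g _ => k * g) (fun g hg => ?_) (fun g _ h _ e => mul_left_cancel e)
      (fun g hg => ⟨k⁻¹ * g, ?_, mul_inv_cancel_left k g⟩) (fun g hg => ?_)
    · rw [hs, map_mul, Equiv.Perm.mul_apply, hs.1 hg, hk1]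
    · rw [hs, map_mul, Equiv.Perm.mul_apply, hs.1 hg, map_inv, Equiv.Perm.inv_eq_iff_eq, hk1]
    · rw [← hk2, mul_inv_rev, map_mul, Equiv.Perm.mul_apply, map_inv φ k,
        ← Equiv.Perm.mul_apply (φ k)⁻¹, inv_mul_cancel, Equiv.Perm.one_apply]
  obtain ⟨c, hc⟩ : ∃ c, ∀ y, y ≠ x → F y = c := by
    by_cases h : ∃ y, y ≠ x
    · obtain ⟨y, hy⟩ := h
      exact ⟨F y, fun z hz => hconst z y hz hy⟩
    · exact ⟨0, fun y hy => (h ⟨y, hy⟩).elim⟩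
  have hFeq : ∀ y, F y = c + if y = x then F x - c else 0 := by
    intro y
    split_ifs with h
    · rw [h]
      ring
    · rw [hc y h, add_zero]
  -- Otherwise `F` would be a non-zero constant, whose sum is not zero.
  have he : F x - c ≠ 0 := by
    intro h0
    have h1 := (mem_sumZero φ F).1 (hW hFW)
    have h2 : ∀ y, F y = F x := fun y => by
      rw [hFeq y, h0, ite_self, add_zero]
      exact (sub_eq_zero.1 h0).symm
    rw [Finset.sum_congr rfl fun y _ => h2 y, Finset.sum_const, nsmul_eq_mul] at h1
    refine mul_ne_zero (Nat.cast_ne_zero.2 (Finset.card_pos.2 ⟨x, Finset.mem_univ x⟩).ne') hFx h1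
  have hmove : ∀ y, ∃ g, φ g x = y := by
    intro y
    by_cases h : y = x
    · exact ⟨1, by simp [h]⟩
    · obtain ⟨g, hg, -⟩ := htrans x y y x (Ne.symm h) h
      exact ⟨g, hg⟩
  choose γ hγ using hmove
  intro v hv
  -- The constant part of the translates cancels because `v` has sum zero.
  have hv' : v = (F x - c)⁻¹ • ∑ y, v y • permRep φ (γ y) F := by
    funext z
    have h1 : ∀ y, permRep φ (γ y) F z = c + if y = z then F x - c else 0 := by
      intro y
      rw [permRep_apply, hFeq, map_inv]
      congr 1
      refine if_congr ?_ rfl rfl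
      rw [Equiv.Perm.inv_eq_iff_eq, hγ, eq_comm]
    simp only [Pi.smul_apply, Finset.sum_apply, smul_eq_mul, h1, mul_add, Finset.sum_add_distrib,
      ← Finset.sum_mul, (mem_sumZero φ v).1 hv, zero_mul, zero_add, mul_ite, mul_zero,
      Finset.sum_ite_eq', Finset.mem_univ, if_true]
    field_simp
  rw [hv']
  exact W.smul_mem _ (W.sum_mem fun y _ => W.smul_mem _ (hinv _ _ hFW))

theorem isIrreducible_sumZero [Fintype K] [Nontrivial Ω] {φ : K →* Equiv.Perm Ω}
    (htrans : ∀ x y z w : Ω, x ≠ y → z ≠ w → ∃ g, φ g x = z ∧ φ g y = w) :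
    (sumZero φ).toRepresentation.IsIrreducible := by
  classical
  refine { exists_pair_ne := ⟨⊥, ⊤, fun h0 => ?_⟩, eq_bot_or_eq_top := fun W => ?_ }
  · obtain ⟨x, y, hxy⟩ := exists_pair_ne Ω
    let v : (sumZero φ).toSubmodule := ⟨Pi.single x 1 - Pi.single y 1, by
      rw [mem_sumZero]
      simp⟩
    have hv : v ∈ (⊥ : Submodule ℂ (sumZero φ).toSubmodule) := by
      have h1 : (⊥ : Submodule ℂ (sumZero φ).toSubmodule) = ⊤ :=
        congrArg Subrepresentation.toSubmodule h0
      rw [h1]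
      exact Submodule.mem_top
    have h2 := congrFun (congrArg Subtype.val ((Submodule.mem_bot ℂ).1 hv)) x
    simp [v, hxy] at h2
  · by_cases hW : W.toSubmodule = ⊥
    · exact Or.inl (Subrepresentation.toSubmodule_injective hW)
    · right
      apply Subrepresentation.toSubmodule_injective
      change W.toSubmodule = ⊤
      have h := sumZero_le_of_ne_bot htrans
        (W := W.toSubmodule.map (sumZero φ).toSubmodule.subtype)
        (Submodule.map_subtype_le _ _)
        (by
          rintro g _ ⟨f, hf, rfl⟩
          exact ⟨_, W.apply_mem_toSubmodule g hf, rfl⟩)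
        (by
          intro h0
          apply hW
          exact Submodule.map_injective_of_injective (Submodule.subtype_injective _)
            (h0.trans (Submodule.map_bot _).symm))
      rw [eq_top_iff]
      intro v _
      obtain ⟨w, hw, hwv⟩ := h v.2
      have : w = v := Subtype.ext hwv
      rwa [← this]

/-- The trace on the subspace equals that of `permRep φ g` composed with the projection `p` onto it,
whose diagonal entries are the fixed-point indicator minus `1 / |Ω|`. -/
theorem character_sumZero [Nonempty Ω] (φ : K →* Equiv.Perm Ω) (g : K) :
    (sumZero φ).toRepresentation.character g = Nat.card {x // φ g x = x} - 1 := by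
  classical
  have hn : (Fintype.card Ω : ℂ) ≠ 0 := Nat.cast_ne_zero.2 Fintype.card_ne_zero
  let p : (Ω → ℂ) →ₗ[ℂ] (Ω → ℂ) :=
    { toFun := fun f x => f x - (Fintype.card Ω : ℂ)⁻¹ * ∑ y, f y
      map_add' := fun f g => by
        ext x
        simp only [Pi.add_apply, Finset.sum_add_distrib]
        ring
      map_smul' := fun c f => by
        ext x
        simp only [Pi.smul_apply, smul_eq_mul, ← Finset.mul_sum, RingHom.id_apply]
        ring }
  have hp : ∀ f x, p f x = f x - (Fintype.card Ω : ℂ)⁻¹ * ∑ y, f y := fun _ _ => rfl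
  have hpmem : ∀ f, p f ∈ (sumZero φ).toSubmodule := by
    intro f
    rw [mem_sumZero]
    simp only [hp, Finset.sum_sub_distrib, Finset.sum_const, Finset.card_univ, nsmul_eq_mul]
    field_simp
    ring
  have hmem : ∀ f, (permRep φ g ∘ₗ p) f ∈ (sumZero φ).toSubmodule := fun f =>
    (sumZero φ).apply_mem_toSubmodule g (hpmem f)
  have h1 := LinearMap.trace_restrict_eq_of_forall_mem (sumZero φ).toSubmodule
    (permRep φ g ∘ₗ p) hmem
  have h2 : (permRep φ g ∘ₗ p).restrict (fun f _ => hmem f) = (sumZero φ).toRepresentation g := by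
    ext f x
    change p f.1 (φ g⁻¹ x) = f.1 (φ g⁻¹ x)
    rw [hp, (mem_sumZero φ f.1).1 f.2, mul_zero, sub_zero]
  rw [h2] at h1
  refine h1.trans ?_
  rw [LinearMap.trace_eq_matrix_trace ℂ (Pi.basisFun ℂ Ω), Matrix.trace]
  have h3 : ∀ x, (LinearMap.toMatrix (Pi.basisFun ℂ Ω) (Pi.basisFun ℂ Ω)
      (permRep φ g ∘ₗ p)).diag x = (if φ g x = x then 1 else 0) - (Fintype.card Ω : ℂ)⁻¹ := by
    intro x
    rw [Matrix.diag_apply, LinearMap.toMatrix_apply]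
    simp only [Pi.basisFun_apply, Pi.basisFun_repr, LinearMap.comp_apply, permRep_apply, hp,
      Finset.mem_univ, if_true, mul_one, Pi.single_apply,
      Finset.sum_ite_eq', map_inv, Equiv.Perm.inv_eq_iff_eq]
    congr 1
    exact if_congr eq_comm rfl rfl
  rw [Finset.sum_congr rfl fun x _ => h3 x, Finset.sum_sub_distrib, Finset.sum_boole,
    Nat.card_eq_fintype_card, Fintype.card_subtype, Finset.sum_const, Finset.card_univ,
    nsmul_eq_mul, mul_inv_cancel₀ hn]

/-- A doubly transitive action defines an irreducible character, its permutation character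
minus one. -/
theorem exists_irr_char_eq_card_fixed_sub_one [Finite K] [Nontrivial Ω] (φ : K →* Equiv.Perm Ω)
    (htrans : ∀ x y z w : Ω, x ≠ y → z ≠ w → ∃ g, φ g x = z ∧ φ g y = w) :
    ∃ π : Irr K, ∀ g, π.char g = Nat.card {x // φ g x = x} - 1 := by
  have := Fintype.ofFinite K
  obtain ⟨π, hπ⟩ := exists_irr_of_isIrreducible _ (isIrreducible_sumZero htrans)
  exact ⟨π, fun g => by rw [hπ, character_sumZero]⟩

end PermutationCharacter

/-! ### Modular invariance of the swap from the values of the character. -/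

section Invariance

variable {G : Type u} [Group G]

theorem Irr.sum_char_eq_zero {K : Type u} [Group K] [Fintype K] {ρ : Irr K}
    (hρ : ρ ≠ Irr.trivial K) : ∑ g, ρ.char g = 0 := by
  classical
  have h1 := Irr.char_orthonormal ρ (Irr.trivial K)
  rw [if_neg hρ] at h1
  have h2 := (mul_eq_zero.1 h1).resolve_left
    (inv_ne_zero (Nat.cast_ne_zero.2 Nat.card_pos.ne'))
  simpa only [Irr.char_trivial, mul_one] using h2

/-- The sum of a non-trivial irreducible character of a normal subgroup `N`, whose non-trivial
elements form one conjugacy class, over the conjugates of an element of `N`. -/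
theorem sum_char_conj_eq [Fintype G] {N : Subgroup G} [hnormal : N.Normal] {ρ : Irr N}
    (hρ : ρ ≠ Irr.trivial N)
    (hconj : ∀ b ∈ N, b ≠ 1 → ∀ c ∈ N, c ≠ 1 → IsConj b c) {a : G} (ha : a ∈ N) (ha1 : a ≠ 1)
    (hmem : ∀ h : G, h⁻¹ * a * h ∈ N) :
    (Nat.card N - 1 : ℂ) * ∑ h : G, ρ.char ⟨h⁻¹ * a * h, hmem h⟩ = - Nat.card G * ρ.char 1 := by
  classical
  let f : G → ℂ := fun g => if hg : g ∈ N then ρ.char ⟨g, hg⟩ else 0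
  have hf : ∀ g (hg : g ∈ N), f g = ρ.char ⟨g, hg⟩ := fun g hg => dif_pos hg
  have hf0 : ∑ g, f g = 0 := by
    rw [← Irr.sum_char_eq_zero hρ, ← Finset.sum_subset (Finset.subset_univ
      (Finset.univ.filter fun g => g ∈ N)) fun g _ hg => dif_neg (by simpa using hg),
      ← Finset.sum_subtype_eq_sum_filter, Finset.subtype_univ]
    exact Finset.sum_congr rfl fun g _ => hf g g.2
  -- The sum of `t` over `N` vanishes because `ρ` is non-trivial. The identity contributes `|G|
  -- ρ(1)`, and the other `|N| - 1` terms are equal since `t` is a class function.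
  let t : G → ℂ := fun n => ∑ h : G, f (h⁻¹ * n * h)
  have htconj : ∀ n c : G, t (c * n * c⁻¹) = t n := by
    intro n c
    refine Fintype.sum_equiv (Equiv.mulLeft c⁻¹) _ _ fun h => ?_
    simp [mul_assoc]
  have ht1 : t 1 = Nat.card G * ρ.char 1 := by
    have : ∀ h : G, f (h⁻¹ * 1 * h) = ρ.char 1 := fun h => by
      rw [mul_one, inv_mul_cancel]
      exact hf 1 N.one_mem
    simp only [t, this, Finset.sum_const, Finset.card_univ, nsmul_eq_mul,
      Nat.card_eq_fintype_card]
  have htn : ∀ n, t n = (if n = 1 then Nat.card G * ρ.char 1 - t a else 0) +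
      if n ∈ N then t a else 0 := by
    intro n
    by_cases hn1 : n = 1
    · rw [if_pos hn1, if_pos (hn1 ▸ N.one_mem), hn1, ht1]
      ring
    · by_cases hn : n ∈ N
      · obtain ⟨c, rfl⟩ := isConj_iff.1 (hconj a ha ha1 n hn hn1)
        rw [if_neg hn1, if_pos hn, htconj, zero_add]
      · rw [if_neg hn1, if_neg hn, add_zero]
        refine Finset.sum_eq_zero fun h _ => dif_neg fun hh => hn ?_
        have := hnormal.conj_mem _ hh h
        simpa [mul_assoc] using this
  have htsum : ∑ n, t n = 0 := by
    rw [Finset.sum_comm]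
    refine Finset.sum_eq_zero fun h _ => ?_
    rw [← hf0]
    exact Fintype.sum_equiv (MulAut.conj h⁻¹).toEquiv _ _ fun n => by simp
  have hcardN : (Finset.univ.filter fun g => g ∈ N).card = Nat.card N := by
    rw [Nat.card_eq_fintype_card, Fintype.card_subtype]
  rw [Finset.sum_congr rfl fun n _ => htn n, Finset.sum_add_distrib, Finset.sum_ite_eq',
    if_pos (Finset.mem_univ _), ← Finset.sum_filter, Finset.sum_const, hcardN,
    nsmul_eq_mul] at htsum
  have hta : t a = ∑ h : G, ρ.char ⟨h⁻¹ * a * h, hmem h⟩ :=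
    Finset.sum_congr rfl fun h _ => hf _ _
  rw [← hta]
  linear_combination htsum

variable [Finite G]

theorem commute_swapMatrix_S {C F : Particle G} (hCC : S G C C = S G F F)
    (hX : ∀ X, X ≠ C → X ≠ F → S G C X = S G F X) : Commute (swapMatrix C F) (S G) := by
  rw [commute_swapMatrix_iff]
  have hcol : ∀ X Y, Y ≠ C → Y ≠ F → S G (Equiv.swap C F X) Y = S G X Y := by
    intro X Y h1 h2
    by_cases hC : X = C
    · rw [hC, Equiv.swap_apply_left, hX Y h1 h2]
    by_cases hF : X = F
    · rw [hF, Equiv.swap_apply_right, hX Y h1 h2]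
    rw [Equiv.swap_apply_of_ne_of_ne hC hF]
  intro X Y
  by_cases hY : Y ≠ C ∧ Y ≠ F
  · rw [Equiv.swap_apply_of_ne_of_ne hY.1 hY.2, hcol X Y hY.1 hY.2]
  by_cases hX' : X ≠ C ∧ X ≠ F
  · rw [Equiv.swap_apply_of_ne_of_ne hX'.1 hX'.2, S_symm, hcol Y X hX'.1 hX'.2, S_symm]
  have hX2 : X = C ∨ X = F := by tauto
  have hY2 : Y = C ∨ Y = F := by tauto
  rcases hX2 with rfl | rfl <;> rcases hY2 with rfl | rfl <;>
    simp only [Equiv.swap_apply_left, Equiv.swap_apply_right]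
  · exact hCC.symm
  · exact S_symm _ _
  · exact S_symm _ _
  · exact hCC

/-- Both twists are 1: for `C` since `a = e`, for `F` since the charge is trivial. -/
theorem commute_swapMatrix_T {C F : Particle G} (hC : C.IsChargeon) (hF : F.IsFluxion) :
    Commute (swapMatrix C F) (T G) := by
  rw [commute_swapMatrix_iff]
  have hTC : T G C C = 1 := by
    rw [T, Matrix.diagonal_apply_eq]
    have : (⟨C.elt, C.elt_mem_cent⟩ : C.cent) = 1 := Subtype.ext ((elt_eq_one_iff C).2 hC)
    rw [this, div_self C.charge.char_one_ne_zero]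
  have hTF : T G F F = 1 := by
    rw [T, Matrix.diagonal_apply_eq, hF.char_eq_one, hF.char_eq_one, div_one]
  intro X Y
  by_cases hXY : X = Y
  · subst hXY
    by_cases h1 : X = C
    · rw [h1, Equiv.swap_apply_left, hTC, hTF]
    by_cases h2 : X = F
    · rw [h2, Equiv.swap_apply_right, hTC, hTF]
    rw [Equiv.swap_apply_of_ne_of_ne h1 h2]
  · rw [T, Matrix.diagonal_apply_ne _ hXY,
      Matrix.diagonal_apply_ne _ fun h => hXY ((Equiv.swap C F).injective h)]

theorem isModularInvariant_swapMatrix {C F : Particle G} (hS : Commute (swapMatrix C F) (S G))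
    (hT : Commute (swapMatrix C F) (T G)) (hC : Particle.vacuum G ≠ C)
    (hF : Particle.vacuum G ≠ F) : IsModularInvariant (swapMatrix C F) where
  commute_S := hS
  commute_T := hT
  entries X Y := by
    rw [swapMatrix, Equiv.Perm.permMatrix, PEquiv.toMatrix_apply]
    split_ifs
    · exact ⟨1, Nat.cast_one.symm⟩
    · exact ⟨0, Nat.cast_zero.symm⟩
  vacuum := by
    rw [swapMatrix, Equiv.Perm.permMatrix, PEquiv.toMatrix_apply, if_pos]
    rw [Equiv.toPEquiv_apply, Equiv.swap_apply_of_ne_of_ne hC hF]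
    rfl

theorem Particle.IsChargeon.sum_char_mul_char_inv [Fintype G] {C X : Particle G}
    (hC : C.IsChargeon) (hX : X.IsChargeon) (hne : X ≠ C) :
    ∑ g : G, C.charge.char ⟨g, hC.mem_cent g⟩ * X.charge.char ⟨g⁻¹, hX.mem_cent _⟩ = 0 := by
  classical
  obtain ⟨c, π⟩ := C
  obtain ⟨x, ρ⟩ := X
  obtain rfl : c = ConjClasses.mk 1 := hC
  obtain rfl : x = ConjClasses.mk 1 := hX
  have := Fintype.ofFinite (Subgroup.centralizer ({classRep (ConjClasses.mk (1 : G))} : Set G))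
  have h1 := Irr.char_orthonormal π ρ
  rw [if_neg fun h => hne (by rw [h])] at h1
  have h2 := (mul_eq_zero.1 h1).resolve_left
    (inv_ne_zero (Nat.cast_ne_zero.2 Nat.card_pos.ne'))
  rw [← h2]
  let e : Subgroup.centralizer ({classRep (ConjClasses.mk (1 : G))} : Set G) ≃ G :=
    Equiv.subtypeUnivEquiv (Particle.vacuum_isChargeon (G := G)).mem_cent
  exact Fintype.sum_equiv e.symm _ _ fun _ => rfl

/-- The rows are compared separately at chargeons, at particles with the flux of `F`, and at fluxes
outside `N`, where both entries vanish. -/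
theorem isModularInvariant_swapMatrix_of_char {C F : Particle G} (hC : C.IsChargeon)
    (hF : F.IsFluxion) (N : Subgroup G) [hnormal : N.Normal] (hFN : F.cent = N)
    (hF1 : ¬ F.IsChargeon) (hconj : ∀ b ∈ N, b ≠ 1 → ∀ c ∈ N, c ≠ 1 → IsConj b c)
    (h1 : C.charge.char 1 = Nat.card N - 1)
    (hN : ∀ g ∈ N, g ≠ 1 → C.charge.char ⟨g, hC.mem_cent g⟩ = -1)
    (hG : ∀ g, g ∉ N → C.charge.char ⟨g, hC.mem_cent g⟩ = 0) :
    IsModularInvariant (swapMatrix C F) := by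
  classical
  have := Fintype.ofFinite G
  subst hFN
  set q : ℂ := (Nat.card F.cent : ℂ) with hq
  have ha : F.elt ∈ F.cent := F.elt_mem_cent
  have ha1 : F.elt ≠ 1 := fun h => hF1 ((elt_eq_one_iff F).1 h)
  have ha' : F.elt⁻¹ ∈ F.cent := F.cent.inv_mem ha
  have ha1' : F.elt⁻¹ ≠ 1 := inv_ne_one.2 ha1
  have hq0 : q ≠ 0 := Nat.cast_ne_zero.2 Nat.card_pos.ne'
  have hd0 : q - 1 ≠ 0 := h1 ▸ C.charge.char_one_ne_zero
  have hcardG : (Nat.card G : ℂ) = (q - 1) * q := by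
    have h2 := card_isConj_mul_card_centralizer F.elt
    have h3 := NearField.card_eq_card_isConj_add_one F.cent ha ha1 (hconj _ ha ha1)
    have h4 : Nat.card (Subgroup.centralizer {F.elt}) = Nat.card F.cent := rfl
    rw [h4] at h2
    rw [← h2, hq, h3]
    push_cast
    ring
  have hG0 : (Nat.card G : ℂ) ≠ 0 := Nat.cast_ne_zero.2 Nat.card_pos.ne'
  have hCC : S G C C = S G F F := by
    rw [hC.S_apply, hC.char_inv_elt, hC.card_cent, hF.S_apply,
      Finset.sum_congr rfl fun h _ => hF.char_eq_one _, Finset.sum_const, Finset.card_univ,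
      Fintype.card_congr (Equiv.subtypeUnivEquiv fun h => hnormal.conj_mem _ ha h),
      ← Nat.card_eq_fintype_card, nsmul_eq_mul, hcardG, h1, ← hq]
    field_simp
  have hX : ∀ X, X ≠ C → X ≠ F → S G C X = S G F X := by
    intro X hXC hXF
    have hzX : (Nat.card X.cent : ℂ) ≠ 0 := Nat.cast_ne_zero.2 Nat.card_pos.ne'
    by_cases hXc : X.IsChargeon
    -- Orthogonality of the two characters reads `(q - 1) ρ(1) - (q - 1) ρ(a⁻¹) = 0`, since all of
    -- `N \ 1` is conjugate to `a⁻¹`.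
    · have hker : X.charge.char ⟨F.elt⁻¹, hXc.mem_cent _⟩ = X.charge.char 1 := by
        have hsum := hC.sum_char_mul_char_inv hXc hXC
        have hterm : ∀ g : G, C.charge.char ⟨g, hC.mem_cent g⟩ *
            X.charge.char ⟨g⁻¹, hXc.mem_cent _⟩ =
            (if g = 1 then (q - 1) * X.charge.char 1 +
              X.charge.char ⟨F.elt⁻¹, hXc.mem_cent _⟩ else 0) +
            if g ∈ F.cent then -X.charge.char ⟨F.elt⁻¹, hXc.mem_cent _⟩ else 0 := by
          intro g
          by_cases hg1 : g = 1
          · subst hg1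
            rw [if_pos rfl, if_pos F.cent.one_mem, ← h1]
            have : (⟨1⁻¹, hXc.mem_cent _⟩ : X.cent) = 1 := Subtype.ext inv_one
            rw [this]
            change C.charge.char 1 * _ = _
            ring
          · by_cases hg : g ∈ F.cent
            · rw [if_neg hg1, if_pos hg, hN g hg hg1, hXc.char_eq_of_isConj
                (hconj _ (F.cent.inv_mem hg) (inv_ne_one.2 hg1) _ ha' ha1')]
              ring
            · rw [if_neg hg1, if_neg hg, hG g hg]
              ring
        have hcardN : (Finset.univ.filter fun g => g ∈ F.cent).card = Nat.card F.cent := by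
          rw [Nat.card_eq_fintype_card, Fintype.card_subtype]
        rw [Finset.sum_congr rfl fun g _ => hterm g, Finset.sum_add_distrib, Finset.sum_ite_eq',
          if_pos (Finset.mem_univ _), ← Finset.sum_filter, Finset.sum_const, hcardN,
          nsmul_eq_mul] at hsum
        refine (mul_left_cancel₀ hd0 ?_).symm
        linear_combination hsum
      rw [S_symm F, hC.S_apply, hXc.S_apply, hker, hF.char_eq_one, hXc.card_cent, hcardG, ← hq]
      have : C.charge.char ⟨X.elt⁻¹, hC.mem_cent _⟩ = q - 1 := by
        rw [← h1]
        congr 1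
        exact Subtype.ext (inv_eq_one.2 ((elt_eq_one_iff X).2 hXc))
      rw [this]
      field_simp
    · have hX1 : X.elt ≠ 1 := fun h => hXc ((elt_eq_one_iff X).1 h)
      by_cases hXN : X.elt ∈ F.cent
      · have hflux : X.flux = F.flux := by
          have h2 := ConjClasses.mk_eq_mk_iff_isConj.2 (hconj _ hXN hX1 _ ha ha1)
          exact (mk_classRep X.flux).symm.trans (h2.trans (mk_classRep F.flux))
        obtain ⟨x, ρ⟩ := X
        obtain rfl : x = F.flux := hflux
        have hρ : ρ ≠ Irr.trivial F.cent := fun h => hXF (Particle.ext rfl (heq_of_eq (by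
          rw [Particle.IsFluxion] at hF
          rw [hF]
          exact h)))
        have hsum := sum_char_conj_eq hρ hconj ha' ha1' fun h => by
          have := hnormal.conj_mem _ ha' h⁻¹
          rwa [inv_inv] at this
        have hCX : C.charge.char ⟨F.elt⁻¹, hC.mem_cent _⟩ = -1 := hN _ ha' ha1'
        rw [hC.S_apply, hF.S_apply]
        change C.charge.char ⟨F.elt⁻¹, hC.mem_cent _⟩ * ρ.char 1 / q = 1 / (q * q) *
          ∑ h : {h : G // h * F.elt * h⁻¹ ∈ F.cent},
            ρ.char ⟨h.1⁻¹ * F.elt⁻¹ * h.1, Particle.inv_conj_mem_cent h.2⟩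
        have hreindex : ∑ h : {h : G // h * F.elt * h⁻¹ ∈ F.cent},
            ρ.char ⟨h.1⁻¹ * F.elt⁻¹ * h.1, Particle.inv_conj_mem_cent h.2⟩ = -q * ρ.char 1 := by
          refine mul_left_cancel₀ hd0 (Eq.trans ?_ (hsum.trans ?_))
          · congr 1
            exact Fintype.sum_equiv (Equiv.subtypeUnivEquiv fun h => hnormal.conj_mem _ ha h)
              _ _ fun _ => rfl
          · rw [hcardG]
            ring
        rw [hreindex, hCX]
        field_simp
      · have hXN' : X.elt⁻¹ ∉ F.cent := fun h => hXN (by simpa using F.cent.inv_mem h)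
        have : IsEmpty {h : G // h * X.elt * h⁻¹ ∈ F.cent} := ⟨fun h => hXN (by
          have := hnormal.conj_mem _ h.2 h.1⁻¹
          simpa [mul_assoc] using this)⟩
        rw [hC.S_apply, hF.S_apply, hG _ hXN', Finset.univ_eq_empty, Finset.sum_empty]
        simp
  refine isModularInvariant_swapMatrix (commute_swapMatrix_S hCC hX) (commute_swapMatrix_T hC hF)
    (fun h => ?_) fun h => hF1 (h ▸ Particle.vacuum_isChargeon)
  -- Were `C` trivial, its character at `a` would be 1 and not `-1`.
  have h2 : C.IsFluxion := h ▸ Particle.vacuum_isFluxion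
  have h3 := hN _ ha ha1
  rw [h2.char_eq_one] at h3
  norm_num at h3

end Invariance

end QuantumDouble

/-! ### The affine group of a near-field. -/

namespace NearField

variable (H : Type u) [NearField H]

theorem mul_sub' (x y z : H) : x * (y - z) = x * y - x * z := by
  rw [eq_sub_iff_add_eq, ← mul_add', sub_add_cancel]

instance : MulAction (Semidirect H) H where
  smul g x := Multiplicative.toAdd g.left + g.right * x
  one_smul x := by
    change (0 : H) + 1 * x = x
    rw [zero_add, one_mul]
  mul_smul g h x := by
    change (Multiplicative.toAdd g.left + g.right * Multiplicative.toAdd h.left) +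
      (g.right * h.right : H) * x =
      Multiplicative.toAdd g.left + g.right * (Multiplicative.toAdd h.left + h.right * x)
    rw [mul_add', mul_assoc, add_assoc]

variable {H}

theorem smul_def (g : Semidirect H) (x : H) :
    g • x = Multiplicative.toAdd g.left + g.right * x := rfl

/-- The linear part must carry `y - x` to `w - z`, which determines it; the translation then
corrects the image of `x`. -/
theorem exists_smul_eq {x y z w : H} (hxy : x ≠ y) (hzw : z ≠ w) :
    ∃ g : Semidirect H, g • x = z ∧ g • y = w := by
  have h1 : y - x ≠ 0 := sub_ne_zero.2 hxy.symm
  have h2 : w - z ≠ 0 := sub_ne_zero.2 hzw.symm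
  let k : Hˣ := Units.mk0 (w - z) h2 * (Units.mk0 (y - x) h1)⁻¹
  have hk : (k : H) * (y - x) = w - z := by
    simp [k, h1]
  refine ⟨⟨Multiplicative.ofAdd (z - k * x), k⟩, sub_add_cancel _ _, ?_⟩
  change z - k * x + k * y = w
  rw [mul_sub'] at hk
  rw [sub_add_eq_add_sub, add_sub_assoc, hk, add_sub_cancel]

/-- The translations. -/
abbrev translations (H : Type u) [NearField H] : Subgroup (Semidirect H) :=
  (SemidirectProduct.inl : Multiplicative H →* Semidirect H).range

instance : (translations H).Normal := by
  rw [translations, SemidirectProduct.range_inl_eq_ker_rightHom]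
  infer_instance

theorem mem_translations {g : Semidirect H} : g ∈ translations H ↔ g.right = 1 := by
  rw [translations, SemidirectProduct.range_inl_eq_ker_rightHom]
  rfl

theorem card_translations : Nat.card (translations H) = Nat.card H :=
  (Nat.card_congr (Equiv.ofInjective _ SemidirectProduct.inl_injective)).symm

theorem card_fixed_of_mem {g : Semidirect H} (hg : g ∈ translations H) (hg1 : g ≠ 1) :
    Nat.card {x : H // g • x = x} = 0 := by
  rw [mem_translations] at hg
  have : IsEmpty {x : H // g • x = x} := ⟨fun x => hg1 (SemidirectProduct.ext ?_ hg)⟩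
  · exact Nat.card_of_isEmpty
  · have h1 := x.2
    rw [smul_def, hg, Units.val_one, one_mul, add_eq_right] at h1
    exact h1

/-- For linear part `α ≠ 1` the map `x ↦ x - α x` is injective, since `α` fixes no non-zero element.
By finiteness it is bijective, so the fixed-point equation has one solution. -/
theorem card_fixed_of_notMem [Finite H] {g : Semidirect H} (hg : g ∉ translations H) :
    Nat.card {x : H // g • x = x} = 1 := by
  rw [mem_translations] at hg
  have hinj : Function.Injective fun x : H => x - g.right * x := by
    intro x y hxy
    by_contra hne
    apply hg
    have h1 : (g.right : H) * (x - y) = 1 * (x - y) := by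
      rw [mul_sub', one_mul]
      have : x - g.right * x = y - g.right * y := hxy
      rw [sub_eq_sub_iff_add_eq_add] at this ⊢
      rw [add_comm _ y, ← this, add_comm]
    exact Units.ext (mul_right_cancel₀ (sub_ne_zero.2 hne) h1)
  have hiff : ∀ x : H, g • x = x ↔ x - g.right * x = Multiplicative.toAdd g.left := fun x => by
    rw [smul_def, sub_eq_iff_eq_add, eq_comm]
  obtain ⟨x, hx⟩ := (Finite.injective_iff_surjective.1 hinj) (Multiplicative.toAdd g.left)
  rw [Nat.card_eq_one_iff_unique]
  exact ⟨⟨fun y z => Subtype.ext (hinj (((hiff _).1 y.2).trans ((hiff _).1 z.2).symm))⟩,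
    ⟨⟨x, (hiff x).2 hx⟩⟩⟩

theorem isConj_inl_one {g : Semidirect H} (hg : g ∈ translations H) (hg1 : g ≠ 1) :
    IsConj (SemidirectProduct.inl (Multiplicative.ofAdd 1) : Semidirect H) g := by
  obtain ⟨x, rfl⟩ := hg
  have hx : Multiplicative.toAdd x ≠ 0 := fun h => hg1 (by
    have : x = 1 := h
    rw [this, map_one])
  -- The linear map with factor `x` conjugates translation by 1 to translation by `x`.
  refine isConj_iff.2 ⟨SemidirectProduct.inr (Units.mk0 _ hx), ?_⟩
  rw [← map_inv, ← SemidirectProduct.inl_aut]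
  exact congrArg _ (congrArg Multiplicative.ofAdd (mul_one (Multiplicative.toAdd x)))

/-- Commuting with translation by `x ≠ 0` means that the linear part fixes `x`; cancelling `x` makes
it 1. -/
theorem centralizer_eq_translations {g : Semidirect H} (hg : g ∈ translations H) (hg1 : g ≠ 1) :
    Subgroup.centralizer {g} = translations H := by
  obtain ⟨x, rfl⟩ := hg
  have hx : Multiplicative.toAdd x ≠ 0 := fun h => hg1 (by
    have : x = 1 := h
    rw [this, map_one])
  ext b
  rw [Subgroup.mem_centralizer_singleton_iff, mem_translations]
  have hleft : (b * SemidirectProduct.inl x = SemidirectProduct.inl x * b) ↔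
      Multiplicative.toAdd b.left + b.right * Multiplicative.toAdd x =
        Multiplicative.toAdd x + (1 : H) * Multiplicative.toAdd b.left := by
    rw [SemidirectProduct.ext_iff]
    exact ⟨fun h => h.1, fun h => ⟨h, (mul_one b.right).trans (one_mul b.right).symm⟩⟩
  rw [hleft, one_mul, add_comm (Multiplicative.toAdd x), add_right_inj]
  constructor
  · intro h
    exact Units.ext (mul_right_cancel₀ hx (h.trans (one_mul _).symm))
  · intro h
    rw [h, Units.val_one, one_mul]

variable (H) in
open QuantumDouble in
/-- The group of affine maps of a near-field has a chargeon and a fluxion whose interchange is a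
modular invariant. -/
theorem exists_isModularInvariant [Finite H] :
    ∃ C F : Particle (Semidirect H), C.IsChargeon ∧ F.IsFluxion ∧ C ≠ F ∧
      IsModularInvariant (swapMatrix C F) := by
  have := Fintype.ofFinite H
  let c : ConjClasses (Semidirect H) := ConjClasses.mk 1
  let φ : Subgroup.centralizer ({classRep c} : Set (Semidirect H)) →* Equiv.Perm H :=
    (MulAction.toPermHom (Semidirect H) H).comp (Subgroup.subtype _)
  have hmem : ∀ g, g ∈ Subgroup.centralizer ({classRep c} : Set (Semidirect H)) := fun g =>
    Particle.IsChargeon.mem_cent (X := Particle.vacuum (Semidirect H)) rfl g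
  obtain ⟨π, hπ⟩ := exists_irr_char_eq_card_fixed_sub_one φ fun x y z w hxy hzw => by
    obtain ⟨g, hg⟩ := exists_smul_eq hxy hzw
    exact ⟨⟨g, hmem g⟩, hg⟩
  let C : Particle (Semidirect H) := ⟨c, π⟩
  let a : Semidirect H := SemidirectProduct.inl (Multiplicative.ofAdd 1)
  let F : Particle (Semidirect H) := ⟨ConjClasses.mk a, Irr.trivial _⟩
  have hC : C.IsChargeon := rfl
  have hF : F.IsFluxion := rfl
  have ha : a ∈ translations H := ⟨_, rfl⟩
  have ha1 : a ≠ 1 := fun h => by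
    have h1 : Multiplicative.ofAdd (1 : H) = 1 :=
      SemidirectProduct.inl_injective (φ := leftMul H) (h.trans (map_one _).symm)
    exact one_ne_zero (α := H) h1
  -- The representative `F.elt` of the class of `a` need not be `a`.
  have hconj : IsConj a F.elt :=
    (ConjClasses.mk_eq_mk_iff_isConj.1 (mk_classRep F.flux)).symm
  have hFc : ¬ F.IsChargeon := fun h => by
    rw [(elt_eq_one_iff F).2 h, isConj_one_left] at hconj
    exact ha1 hconj
  have hFN : F.elt ∈ translations H := by
    obtain ⟨b, hb⟩ := isConj_iff.1 hconj
    rw [← hb]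
    exact Subgroup.Normal.conj_mem inferInstance _ ha _
  have hchar : ∀ g, C.charge.char ⟨g, hC.mem_cent g⟩ = Nat.card {x : H // g • x = x} - 1 :=
    fun g => hπ ⟨g, hmem g⟩
  refine ⟨C, F, hC, hF, fun h => hFc (h ▸ hC), isModularInvariant_swapMatrix_of_char hC hF
    (translations H) (centralizer_eq_translations hFN fun h => hFc ((elt_eq_one_iff F).1 h)) hFc
    (fun b hb hb1 d hd hd1 => (isConj_inl_one hb hb1).symm.trans (isConj_inl_one hd hd1))
    ?_ ?_ ?_⟩
  · refine (hchar 1).trans ?_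
    rw [card_translations, Nat.card_congr (Equiv.subtypeUnivEquiv fun x => one_smul _ x)]
  · intro g hg hg1
    rw [hchar, card_fixed_of_mem hg hg1]
    simp
  · intro g hg
    rw [hchar, card_fixed_of_notMem hg]
    simp

end NearField

theorem theorem4p2 :
    (∀ (G : Type u) [Group G] [Finite G] (C F : QuantumDouble.Particle G),
      C.IsChargeon → F.IsFluxion → C ≠ F →
      Commute (QuantumDouble.swapMatrix C F) (QuantumDouble.S G) →
      Commute (QuantumDouble.swapMatrix C F) (QuantumDouble.T G) →
      ∃ (H : Type u) (_ : NearField H),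
        Finite H ∧ Nonempty (G ≃* NearField.Semidirect H)) ∧
    (∀ (H : Type u) [NearField H] [Finite H],
      ∃ C F : QuantumDouble.Particle (NearField.Semidirect H),
        C.IsChargeon ∧ F.IsFluxion ∧ C ≠ F ∧
        QuantumDouble.IsModularInvariant (QuantumDouble.swapMatrix C F)) :=
  ⟨fun _ _ _ _ _ hC hF hne hS _ => QuantumDouble.exists_nearField_of_commute_S hC hF hne hS,
    fun H _ _ => NearField.exists_isModularInvariant H⟩
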